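/- **Setting.** There are $n\ge 1$ workers, indexed so that their computation times satisfy $0<\tau_1\le\tau_2\le\dots\le\tau_n$. *Worker oracle.* Let $\widehat\nabla F:\mathbb R^d\times\Xi\to\mathbb R^d$ be a stochastic gradient map and let $\mathcal D$ be a probability distribution on $\Xi$. Each worker $i$ has a state $s=(s_t,s_x,s_q)\in\mathbb R_{\ge0}\times\mathbb R^d\times\{0,1\}$, consisting of the start time, the requested point, and idle $(0)$ or busy $(1)$. The initial state is $(0,0,0)$. A call to worker $i$ at time $t$ with point $x$ replaces the state $s$ by $s_+$ and outputs a vector $g$, where $$(s_+,g)=\begin{cases}((t,x,1),\,0), & s_q=0,\\ ((s_t,s_x,1),\,0), & s_q=1,\ t<s_t+\tau_i,\\ ((0,0,0),\,\widehat\nabla F(s_x;\xi)), & s_q=1,\ t\ge s_t+\tau_i,\end{cases}$$ with a fresh independent sample $\xi\sim\mathcal D$ at every call. *Algorithms.* An asynchronous zero-respecting algorithm is a sequence of maps $A_k:(g_1,\dots,g_k)\mapsto(t_{k+1},i_{k+1},x_k)$, $k\ge 0$, such that, for all inputs, $0=t_0\le t_1\le t_2\le\dots$ and $\mathrm{supp}(x_k)\subseteq\bigcup_{s=1}^k\mathrm{supp}(g_s)$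 (in particular $x_0=0$). At round $k$ it calls worker $i_{k+1}$ at time $t_{k+1}$ with the point $x_k$, and $g_{k+1}$ is the output of this call. The iterate $x_k$ is available from time $t_k$ on. **Theorem.** There is a universal constant $c>0$, and for every $p\in(1,2]$ a constant $C>0$ depending only on $p$, such that the following holds. For all $L,\Delta,\sigma>0$, all $0<\epsilon\le c\sqrt{L\Delta}$, all $n\ge1$ and all $0<\tau_1\le\dots\le\tau_n$, there exist a dimension $d$, a function $f:\mathbb R^d\to\mathbb R$ that is differentiable with $L$-Lipschitz gradient, bounded below and satisfies $f(0)-\inf_{x\in\mathbb R^d} f(x)\le\Delta$, a probability distribution $\mathcal D$, and a jointly measurable stochastic gradient map $\widehat\nabla F$ such that for all $x\in\mathbb R^d$ $$\mathbb E_{\xi\sim\mathcal D}[\widehat\nabla F(x;\xi)]=\nabla f(x),\qquad \mathbb E_{\xi\sim\mathcal D}\big[\|\widehat\nabla F(x;\xi)-\nabla f(x)\|^p\big]\le\sigma^p,$$ and such that every asynchronous zero-respecting algorithm, run with these oracles, needs at least the time $$C\,\min_{1\le m\le n}\left[\left(\frac1m\sum_{i=1}^m\frac1{\tau_i}\right)^{-1}\left(\frac{L\Delta}{\epsilon^2}+\frac{L\,\sigma^{\frac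 p{p-1}}\,\Delta}{m\,\epsilon^{\frac{3p-2}{p-1}}}\right)\right]$$ to find an $\epsilon$-stationary point in expectation. That is, every $t$ with $\mathbb E\big[\inf_{k:\,t_k\le t}\|\nabla f(x_k)\|\big]\le\epsilon$ is at least this large. In particular, this holds for every $t$ for which some possibly random $\hat x$, always chosen among the iterates $x_k$ with $t_k\le t$, satisfies $\mathbb E\|\nabla f(\hat x)\|\le\epsilon$. -/

import Mathlib

open MeasureTheory

/-- `ℝ^d` with its Euclidean norm. -/
abbrev Vec (d : ℕ) : Type := EuclideanSpace ℝ (Fin d)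

/-- `f : ℝ^d → ℝ` is differentiable with `L`-Lipschitz gradient. -/
def IsLSmooth {d : ℕ} (L : ℝ) (f : Vec d → ℝ) : Prop :=
  Differentiable ℝ f ∧ ∀ x y : Vec d, ‖gradient f x - gradient f y‖ ≤ L * ‖x - y‖

/-- With `ξ ∼ D`, the estimator `G x ξ` of `∇f x` is unbiased and its `p`-th central moment is at
most `σ ^ p`, at every point `x`. -/
structure IsPBCMEstimator {d : ℕ} {Ξ : Type} [MeasurableSpace Ξ] (D : Measure Ξ)
    (p σ : ℝ) (f : Vec d → ℝ) (G : Vec d → Ξ → Vec d) : Prop where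
  measurable : Measurable (Function.uncurry G)
  integrable : ∀ x, Integrable (G x) D
  unbiased : ∀ x, ∫ ξ, G x ξ ∂D = gradient f x
  moment : ∀ x, ∫⁻ ξ, ‖G x ξ - gradient f x‖ₑ ^ p ∂D ≤ ENNReal.ofReal (σ ^ p)

/-- The internal state `(s_t, s_x, s_q)` of a worker. -/
structure WorkerState (d : ℕ) where
  startTime : ℝ
  point : Vec d
  busy : Bool

/-- The state `(0, 0, 0)` of an idle worker. -/
def WorkerState.idle (d : ℕ) : WorkerState d := ⟨0, 0, false⟩

open Classical in
/-- The time-sensitive oracle of a worker that needs time `τ` for one stochastic gradient. It is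
called at time `t` with requested point `x`, the worker being in state `s`; `ξ` is the sample that
is used if a stochastic gradient is returned. -/
noncomputable def timeOracle {d : ℕ} {Ξ : Type} (G : Vec d → Ξ → Vec d) (τ : ℝ)
    (t : ℝ) (x : Vec d) (s : WorkerState d) (ξ : Ξ) : WorkerState d × Vec d :=
  if s.busy = false then (⟨t, x, true⟩, 0)
  else if t < s.startTime + τ then (⟨s.startTime, s.point, true⟩, 0)
  else (WorkerState.idle d, G s.point ξ)

/-- What an algorithm decides at round `k`: the time `t_{k+1}` and the worker `i_{k+1}` of the next
oracle call, and the point `x_k`, at which that call is made. -/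
structure Query (n d : ℕ) where
  time : ℝ
  worker : Fin n
  point : Vec d

/-- An asynchronous zero-respecting first-order algorithm for `n` workers in `ℝ^d`: the maps
`A_k : (g_1, …, g_k) ↦ (t_{k+1}, i_{k+1}, x_k)`, where the vector `g_{s+1}` is `g s` for
`s : Fin k`. Times start from `t_0 = 0` and never decrease, and the support of `x_k` is contained
in the union of the supports of `g_1, …, g_k` (in particular `x_0 = 0`). -/
structure AsyncAlgorithm (n d : ℕ) where
  step : (k : ℕ) → (Fin k → Vec d) → Query n d
  time_nonneg : ∀ g : Fin 0 → Vec d, 0 ≤ (step 0 g).time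
  time_mono : ∀ (k : ℕ) (g : Fin (k + 1) → Vec d),
    (step k (fun s : Fin k => g s.castSucc)).time ≤ (step (k + 1) g).time
  support_subset : ∀ (k : ℕ) (g : Fin k → Vec d) (j : Fin d),
    (step k g).point j ≠ 0 → ∃ s : Fin k, g s j ≠ 0

/-- The situation after `k` oracle calls: their outputs `g_1, …, g_k` and the states of all
workers. -/
structure RunState (n d k : ℕ) where
  grads : Fin k → Vec d
  workers : Fin n → WorkerState d

namespace AsyncAlgorithm

variable {n d : ℕ} {Ξ : Type}

/-- The run of the algorithm when worker `i` needs time `τ i` per stochastic gradient and `ω k` is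
the sample available to the oracle call of round `k`. All workers are idle at the beginning. -/
noncomputable def run (A : AsyncAlgorithm n d) (τ : Fin n → ℝ) (G : Vec d → Ξ → Vec d)
    (ω : ℕ → Ξ) : (k : ℕ) → RunState n d k
  | 0 => ⟨Fin.elim0, fun _ => WorkerState.idle d⟩
  | k + 1 =>
    let r := A.run τ G ω k
    let a := A.step k r.grads
    let out := timeOracle G (τ a.worker) a.time a.point (r.workers a.worker) (ω k)
    ⟨Fin.snoc (α := fun _ => Vec d) r.grads out.2, Function.update r.workers a.worker out.1⟩

/-- The iterate `x_k`. -/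
noncomputable def iterate (A : AsyncAlgorithm n d) (τ : Fin n → ℝ) (G : Vec d → Ξ → Vec d)
    (ω : ℕ → Ξ) (k : ℕ) : Vec d :=
  (A.step k (A.run τ G ω k).grads).point

/-- The wall-clock times `t_0 = 0 ≤ t_1 ≤ t_2 ≤ …`; the iterate `x_k` is available from time `t_k`
on. -/
noncomputable def clock (A : AsyncAlgorithm n d) (τ : Fin n → ℝ) (G : Vec d → Ξ → Vec d)
    (ω : ℕ → Ξ) : ℕ → ℝ
  | 0 => 0
  | k + 1 => (A.step k (A.run τ G ω k).grads).time

/-- `E [ inf { ‖∇f (x_k)‖ : t_k ≤ t } ]`, where each oracle call uses a fresh independent sample of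
law `D`. It is a lower bound for `E ‖∇f x̂‖` for every `x̂` chosen among the iterates available by
time `t`. -/
noncomputable def expectedMinGrad [MeasurableSpace Ξ] (A : AsyncAlgorithm n d) (τ : Fin n → ℝ)
    (D : Measure Ξ) (G : Vec d → Ξ → Vec d) (f : Vec d → ℝ) (t : ℝ) : ENNReal :=
  ∫⁻ ω, ⨅ (k : ℕ) (_ : A.clock τ G ω k ≤ t), ‖gradient f (A.iterate τ G ω k)‖ₑ
    ∂(Measure.infinitePi fun _ : ℕ => D)

end AsyncAlgorithm

/-- `min_{1 ≤ m ≤ n} (1/m ∑_{i ≤ m} 1/τ_i)⁻¹ (LΔ/ε² + L σ^{p/(p-1)} Δ / (m ε^{(3p-2)/(p-1)}))`; the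
element `j` of `Fin n` stands for `m = j + 1`. -/
noncomputable def lowerRate {n : ℕ} (τ : Fin n → ℝ) (L Δ p σ ε : ℝ) : ℝ :=
  ⨅ j : Fin n, (1 / ((j : ℝ) + 1) * ∑ i ∈ Finset.Iic j, 1 / τ i)⁻¹ *
    (L * Δ / ε ^ 2 +
      L * σ ^ (p / (p - 1)) * Δ / (((j : ℝ) + 1) * ε ^ ((3 * p - 2) / (p - 1))))

/-! The objective is a nonconvex chain. At a point supported on the first `a` coordinates its
gradient is supported on the first `a + 1`, and the gradient norm stays bounded below while the last
coordinate is zero. A zero-respecting algorithm must therefore uncover the coordinates one by one.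
The oracle multiplies the single new coordinate by a Bernoulli(`q`) variable divided by `q`, with
`q` of order `min 1 ((ε/σ)^(p/(p-1)))`, as small as the `p`-th moment allows up to constants.

Fix a time scale `s` and call a worker fast if `τ i ≤ s`. Only a computation started at a point that
uses every coordinate found so far can reveal the next one. If a slow worker reveals it, more than
time `s` has passed since that start; if a fast worker reveals it, a coin has succeeded. Hence the
number of revealed coordinates is at most elapsed time over `s` plus the number of fast successes
(`exists_level`). Worker `i` delivers at most `t / τ i` gradients by time `t`, and each coin is
independent of the past, so the expected number of fast successes is at most `q t ∑ 1 / τ i`, summed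
over fast workers.

If `q s ∑ 1 / τ i ≤ 1`, then up to time `s * dim / 4` the elapsed time accounts for at most `dim /
4` coordinates and, by Markov, the successes for fewer than `dim / 2` with probability at least
`1/2`. Then the last coordinate is still zero (`ofReal_le_expectedMinGrad`). Half the minimum over
`m` of `(m + 1/q) / ∑_{i ≤ m} 1/τ i` is an admissible `s` (`rate_mul_sum_le_one`); multiplied by a
dimension of order `LΔ/ε²` it gives the rate. -/

/-! ### One-dimensional building blocks. -/

/-- Half of the square of the positive part. -/
noncomputable def halfSq (x : ℝ) : ℝ := max x 0 ^ 2 / 2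

/-- A piecewise quadratic step from `0` (on `x ≤ 0`) to `1` (on `x ≥ 2`). -/
noncomputable def smoothStep (x : ℝ) : ℝ := halfSq x - 2 * halfSq (x - 1) + halfSq (x - 2)

/-- The derivative of `smoothStep`. -/
noncomputable def hat (x : ℝ) : ℝ := max (1 - |x - 1|) 0

lemma hasDerivAt_halfSq (x : ℝ) : HasDerivAt halfSq (max x 0) x := by
  rcases lt_trichotomy x 0 with h | rfl | h
  · rw [max_eq_right h.le]
    refine (hasDerivAt_const x (0 : ℝ)).congr_of_eventuallyEq ?_
    filter_upwards [Iio_mem_nhds h] with y hy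
    simp [halfSq, max_eq_right (le_of_lt (Set.mem_Iio.1 hy))]
  · rw [max_self, hasDerivAt_iff_isLittleO]
    have h0 : halfSq 0 = 0 := by simp [halfSq]
    simp only [h0, sub_zero, smul_zero]
    have : (fun y : ℝ => y ^ 2) =o[nhds 0] (fun y : ℝ => y) := by
      simpa using (Asymptotics.isLittleO_pow_id (𝕜 := ℝ) (n := 2) (by norm_num))
    refine Asymptotics.IsBigO.trans_isLittleO (Asymptotics.IsBigO.of_bound 1 ?_) this
    refine Filter.Eventually.of_forall fun y => ?_
    rw [Real.norm_eq_abs, Real.norm_eq_abs, abs_of_nonneg (sq_nonneg y), halfSq,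
      abs_of_nonneg (by positivity)]
    rcases le_total y 0 with hy | hy
    · simp [max_eq_right hy]; positivity
    · rw [max_eq_left hy]; nlinarith [sq_nonneg y]
  · rw [max_eq_left h.le]
    have h1 : HasDerivAt (fun y : ℝ => y ^ 2 / 2) x x := by
      simpa using ((hasDerivAt_id x).pow 2).div_const 2
    refine h1.congr_of_eventuallyEq ?_
    filter_upwards [Ioi_mem_nhds h] with y hy
    simp [halfSq, max_eq_left (le_of_lt (Set.mem_Ioi.1 hy))]

lemma hasDerivAt_smoothStep (x : ℝ) : HasDerivAt smoothStep (hat x) x := by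
  have h := ((hasDerivAt_halfSq x).sub
    ((HasDerivAt.comp_sub_const x 1 (hasDerivAt_halfSq (x - 1))).const_mul 2)).add
    (HasDerivAt.comp_sub_const x 2 (hasDerivAt_halfSq (x - 2)))
  refine h.congr_deriv ?_
  unfold hat
  grind

lemma hat_nonneg (x : ℝ) : 0 ≤ hat x := le_max_right _ _

lemma hat_le_one (x : ℝ) : hat x ≤ 1 :=
  max_le (by linarith [abs_nonneg (x - 1)]) zero_le_one

lemma abs_hat_sub_le (x y : ℝ) : |hat x - hat y| ≤ |x - y| := by
  unfold hat
  grind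

lemma abs_posPart_sub_le (x y : ℝ) : |max x 0 - max y 0| ≤ |x - y| := by
  grind

lemma hat_zero : hat 0 = 0 := by norm_num [hat]

lemma smoothStep_of_nonpos {x : ℝ} (hx : x ≤ 0) : smoothStep x = 0 := by
  simp [smoothStep, halfSq, max_eq_right hx, max_eq_right (show x - 1 ≤ 0 by linarith),
    max_eq_right (show x - 2 ≤ 0 by linarith)]

lemma smoothStep_of_two_le {x : ℝ} (hx : 2 ≤ x) : smoothStep x = 1 := by
  rw [smoothStep, halfSq, halfSq, halfSq, max_eq_left (by linarith), max_eq_left (by linarith),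
    max_eq_left (by linarith)]
  ring

lemma monotone_smoothStep : Monotone smoothStep :=
  monotone_of_deriv_nonneg (fun x => (hasDerivAt_smoothStep x).differentiableAt)
    fun x => (hasDerivAt_smoothStep x).deriv ▸ hat_nonneg x

lemma smoothStep_nonneg (x : ℝ) : 0 ≤ smoothStep x := by
  rcases le_total x 0 with h | h
  · exact (smoothStep_of_nonpos h).ge
  · exact (smoothStep_of_nonpos le_rfl).ge.trans (monotone_smoothStep h)

lemma smoothStep_le_one (x : ℝ) : smoothStep x ≤ 1 := by
  rcases le_total x 2 with h | h
  · exact (monotone_smoothStep h).trans (smoothStep_of_two_le le_rfl).le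
  · exact (smoothStep_of_two_le h).le

lemma abs_smoothStep_sub_le (x y : ℝ) : |smoothStep x - smoothStep y| ≤ |x - y| := by
  have := Convex.norm_image_sub_le_of_norm_hasDerivWithin_le (f := smoothStep) (f' := hat)
    (s := Set.univ) (C := 1) (x := y) (y := x)
    (fun z _ => (hasDerivAt_smoothStep z).hasDerivWithinAt)
    (fun z _ => by rw [Real.norm_eq_abs, abs_of_nonneg (hat_nonneg z)]; exact hat_le_one z)
    convex_univ trivial trivial
  simpa using this

lemma smoothStep_half_le {x : ℝ} (hx : 1 / 2 ≤ x) : 1 / 8 ≤ smoothStep x := by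
  refine le_trans (le_of_eq ?_) (monotone_smoothStep hx)
  norm_num [smoothStep, halfSq]

lemma halfSq_nonneg (x : ℝ) : 0 ≤ halfSq x := by unfold halfSq; positivity

/-! ### The chain: gradient, smoothness, lower bound on the gradient. -/

/-- The coordinates of `x`, preceded by the constant `2` and followed by zeros. -/
noncomputable def padded {d : ℕ} (x : Vec d) : ℕ → ℝ
  | 0 => 2
  | k + 1 => if h : k < d then x ⟨k, h⟩ else 0

/-- The linear part of `fun x => padded x k`. -/
noncomputable def paddedLinear (d : ℕ) : ℕ → (Vec d →L[ℝ] ℝ)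
  | 0 => 0
  | k + 1 => if h : k < d then EuclideanSpace.proj (𝕜 := ℝ) (⟨k, h⟩ : Fin d) else 0

lemma paddedLinear_zero (d : ℕ) : paddedLinear d 0 = 0 := rfl

lemma paddedLinear_of_lt {d : ℕ} (v : Vec d) {k : ℕ} (h : k < d) :
    paddedLinear d (k + 1) v = v ⟨k, h⟩ := by
  simp [paddedLinear, h]

lemma paddedLinear_of_le {d k : ℕ} (h : d ≤ k) : paddedLinear d (k + 1) = 0 := by
  simp [paddedLinear, h]

lemma padded_sub_padded {d : ℕ} (x y : Vec d) (k : ℕ) :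
    padded x k - padded y k = paddedLinear d k (x - y) := by
  cases k with
  | zero => simp [padded, paddedLinear]
  | succ k =>
    by_cases h : k < d <;> simp [padded, paddedLinear, h]

lemma padded_succ_of_lt {d : ℕ} (x : Vec d) {k : ℕ} (h : k < d) :
    padded x (k + 1) = x ⟨k, h⟩ := by
  simp [padded, h]

lemma hasFDerivAt_padded {d : ℕ} (x : Vec d) (k : ℕ) :
    HasFDerivAt (fun y : Vec d => padded y k) (paddedLinear d k) x := by
  cases k with
  | zero => exact hasFDerivAt_const 2 x
  | succ k =>
    by_cases h : k < d
    · simpa [padded, paddedLinear, h] using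
        (EuclideanSpace.proj (𝕜 := ℝ) (⟨k, h⟩ : Fin d)).hasFDerivAt
    · simpa [padded, paddedLinear, h] using hasFDerivAt_const (0 : ℝ) x

/-- The hard instance: a nonconvex chain in which every coordinate has to be activated by the
preceding one. -/
noncomputable def chain (d : ℕ) (x : Vec d) : ℝ :=
  ∑ k ∈ Finset.range (d + 1), -(smoothStep (padded x k) * smoothStep (padded x (k + 1) + 1)) +
    ∑ k ∈ Finset.range d, halfSq (-padded x (k + 1))

/-- The partial derivatives of `chain`, in terms of the padded coordinates. -/
noncomputable def chainPartial (X : ℕ → ℝ) (j : ℕ) : ℝ :=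
  -(smoothStep (X j) * hat (X (j + 1) + 1)) - hat (X (j + 1)) * smoothStep (X (j + 2) + 1)
    - max (-X (j + 1)) 0

/-- The gradient of `chain`. -/
noncomputable def chainGrad {d : ℕ} (x : Vec d) : Vec d :=
  WithLp.toLp 2 fun j : Fin d => chainPartial (padded x) j

lemma hasGradientAt_chain {d : ℕ} (x : Vec d) : HasGradientAt (chain d) (chainGrad x) x := by
  rw [hasGradientAt_iff_hasFDerivAt]
  have h1 : ∀ k, HasFDerivAt (fun y : Vec d => smoothStep (padded y k))
      (hat (padded x k) • paddedLinear d k) x := fun k =>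
    (hasDerivAt_smoothStep _).comp_hasFDerivAt x (hasFDerivAt_padded x k)
  have h2 : ∀ k, HasFDerivAt (fun y : Vec d => smoothStep (padded y k + 1))
      (hat (padded x k + 1) • paddedLinear d k) x := fun k =>
    (hasDerivAt_smoothStep _).comp_hasFDerivAt x ((hasFDerivAt_padded x k).add_const 1)
  have h3 : ∀ k, HasFDerivAt (fun y : Vec d => halfSq (-padded y k))
      (max (-padded x k) 0 • -paddedLinear d k) x := fun k =>
    (hasDerivAt_halfSq _).comp_hasFDerivAt x (hasFDerivAt_padded x k).neg
  have H := (HasFDerivAt.fun_sum (u := Finset.range (d + 1))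
      fun k _ => ((h1 k).fun_mul (h2 (k + 1))).fun_neg).fun_add
    (HasFDerivAt.fun_sum (u := Finset.range d) fun k _ => h3 (k + 1))
  refine H.congr_fderiv ?_
  ext v
  rw [InnerProductSpace.toDual_apply_apply]
  have e : inner ℝ (chainGrad x) v =
      ∑ j ∈ Finset.range d, chainPartial (padded x) j * paddedLinear d (j + 1) v := by
    rw [Finset.sum_range, PiLp.inner_apply]
    refine Finset.sum_congr rfl fun j _ => ?_
    rw [paddedLinear_of_lt v j.2]
    simp [chainGrad, mul_comm]
  rw [e]
  simp only [add_apply, sum_apply,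
    neg_apply, smul_apply, smul_eq_mul, neg_add,
    Finset.sum_add_distrib]
  rw [Finset.sum_range_succ, paddedLinear_of_le le_rfl,
    Finset.sum_range_succ' (fun k => -(smoothStep (padded x (k + 1) + 1) *
      (hat (padded x k) * (paddedLinear d k) v))), paddedLinear_zero]
  simp only [zero_apply, mul_zero, neg_zero, add_zero]
  rw [← Finset.sum_add_distrib, ← Finset.sum_add_distrib]
  refine Finset.sum_congr rfl fun k _ => ?_
  unfold chainPartial
  ring

/-- All factors are 1-Lipschitz with values in `[0, 1]`, so products cost the sum of the increments.
The weight 3 arises because `X (j + 1)` occurs in all three terms. -/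
lemma abs_chainPartial_sub_le (X Y : ℕ → ℝ) (j : ℕ) :
    |chainPartial X j - chainPartial Y j| ≤
      |X j - Y j| + 3 * |X (j + 1) - Y (j + 1)| + |X (j + 2) - Y (j + 2)| := by
  have prod : ∀ a b a' b' D E : ℝ, |a - a'| ≤ D → |b - b'| ≤ E → 0 ≤ b → b ≤ 1 → 0 ≤ a' →
      a' ≤ 1 → |a * b - a' * b'| ≤ D + E := by
    intro a b a' b' D E h1 h2 h3 h4 h5 h6
    have : a * b - a' * b' = (a - a') * b + a' * (b - b') := by ring
    rw [this]
    refine (abs_add_le _ _).trans (add_le_add ?_ ?_)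
    · rw [abs_mul, abs_of_nonneg h3]
      nlinarith [abs_nonneg (a - a')]
    · rw [abs_mul, abs_of_nonneg h5]
      nlinarith [abs_nonneg (b - b')]
  have h1 := prod _ _ _ _ _ _ (abs_smoothStep_sub_le (X j) (Y j))
    (abs_hat_sub_le (X (j + 1) + 1) (Y (j + 1) + 1)) (hat_nonneg _) (hat_le_one _)
    (smoothStep_nonneg _) (smoothStep_le_one _)
  have h2 := prod _ _ _ _ _ _ (abs_hat_sub_le (X (j + 1)) (Y (j + 1)))
    (abs_smoothStep_sub_le (X (j + 2) + 1) (Y (j + 2) + 1)) (smoothStep_nonneg _)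
    (smoothStep_le_one _) (hat_nonneg _) (hat_le_one _)
  have h3 := abs_posPart_sub_le (-X (j + 1)) (-Y (j + 1))
  rw [add_sub_add_right_eq_sub] at h1 h2
  rw [neg_sub_neg, abs_sub_comm (Y (j + 1))] at h3
  unfold chainPartial
  rw [abs_le] at h1 h2 h3 ⊢
  constructor <;> linarith

lemma norm_chainGrad_sub_le {d : ℕ} (x y : Vec d) :
    ‖chainGrad x - chainGrad y‖ ≤ 5 * ‖x - y‖ := by
  set D : ℕ → ℝ := fun k => |padded x k - padded y k| with hD
  have hsum : ∑ k ∈ Finset.range d, D (k + 1) ^ 2 = ‖x - y‖ ^ 2 := by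
    rw [EuclideanSpace.norm_sq_eq, Finset.sum_range]
    refine Finset.sum_congr rfl fun j _ => ?_
    rw [hD]
    simp only
    rw [padded_sub_padded, paddedLinear_of_lt _ j.2, Real.norm_eq_abs]
  have h0 : ∑ k ∈ Finset.range d, D k ^ 2 ≤ ‖x - y‖ ^ 2 := by
    have := Finset.sum_range_succ' (fun k => D k ^ 2) d
    rw [Finset.sum_range_succ, hsum] at this
    have h : D 0 = 0 := by simp [hD, padded]
    rw [h] at this
    nlinarith [sq_nonneg (D d)]
  have h2 : ∑ k ∈ Finset.range d, D (k + 2) ^ 2 ≤ ‖x - y‖ ^ 2 := by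
    have := Finset.sum_range_succ' (fun k => D (k + 1) ^ 2) d
    rw [Finset.sum_range_succ, hsum] at this
    have h : D (d + 1) = 0 := by simp [hD, padded]
    rw [h] at this
    nlinarith [sq_nonneg (D (0 + 1))]
  refine le_of_sq_le_sq ?_ (by positivity)
  rw [EuclideanSpace.norm_sq_eq]
  -- Cauchy–Schwarz with weights 1, 3, 1 of total 5. Each shifted sum is at most `‖x - y‖ ^ 2`,
  -- since the padding cancels in differences, which gives `5 * 5 = 5 ^ 2`.
  calc ∑ j : Fin d, ‖(chainGrad x - chainGrad y) j‖ ^ 2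
      ≤ ∑ j : Fin d, 5 * (D j ^ 2 + 3 * D (j + 1) ^ 2 + D (j + 2) ^ 2) := by
        refine Finset.sum_le_sum fun j _ => ?_
        have h := abs_chainPartial_sub_le (padded x) (padded y) j
        have e : (chainGrad x - chainGrad y) j =
          chainPartial (padded x) j - chainPartial (padded y) j := rfl
        rw [e, Real.norm_eq_abs]
        refine (pow_le_pow_left₀ (abs_nonneg _) h 2).trans ?_
        change (D j + 3 * D (j + 1) + D (j + 2)) ^ 2 ≤ _
        nlinarith [sq_nonneg (D j - D (j + 1)), sq_nonneg (D (j + 1) - D (j + 2)),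
          sq_nonneg (D j - D (j + 2))]
    _ = 5 * (∑ k ∈ Finset.range d, D k ^ 2 + 3 * ∑ k ∈ Finset.range d, D (k + 1) ^ 2 +
          ∑ k ∈ Finset.range d, D (k + 2) ^ 2) := by
        rw [Finset.sum_range, Finset.sum_range, Finset.sum_range, ← Finset.mul_sum,
          Finset.sum_add_distrib, Finset.sum_add_distrib, Finset.mul_sum]
    _ ≤ (5 * ‖x - y‖) ^ 2 := by rw [hsum]; nlinarith

lemma le_norm_chainGrad {d : ℕ} (x : Vec (d + 1)) (hx : x (Fin.last d) = 0) :
    1 / 16 ≤ ‖chainGrad x‖ := by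
  -- The padded sequence starts at 2 and reaches 0 at the last coordinate, so somewhere it crosses
  -- `1/2`; the partial derivative there is large.
  have key : ∀ m, padded x m < 1 / 2 → ∃ j < m, 1 / 2 ≤ padded x j ∧ padded x (j + 1) < 1 / 2 := by
    intro m
    induction m with
    | zero => intro h; norm_num [padded] at h
    | succ m ih =>
      intro h
      by_cases hm : padded x m < 1 / 2
      · obtain ⟨j, hj, h'⟩ := ih hm
        exact ⟨j, by omega, h'⟩
      · exact ⟨m, by omega, not_lt.1 hm, h⟩
  have hlast : padded x (d + 1) = 0 := by
    rw [padded_succ_of_lt x (Nat.lt_succ_self d)]; exact hx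
  obtain ⟨j, hj, h1, h2⟩ := key (d + 1) (by rw [hlast]; norm_num)
  have hn := PiLp.norm_apply_le (chainGrad x) (⟨j, hj⟩ : Fin (d + 1))
  refine le_trans ?_ hn
  have e : chainGrad x ⟨j, hj⟩ = chainPartial (padded x) j := rfl
  rw [e, Real.norm_eq_abs]
  refine le_trans ?_ (neg_le_abs _)
  unfold chainPartial
  have a1 := smoothStep_half_le h1
  have a2 := hat_nonneg (padded x (j + 1) + 1)
  have a3 : 0 ≤ hat (padded x (j + 1)) * smoothStep (padded x (j + 2) + 1) :=
    mul_nonneg (hat_nonneg _) (smoothStep_nonneg _)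
  -- All three terms of the partial derivative have the same sign, so one suffices: the quadratic
  -- penalty for very negative coordinates, otherwise the product, at least `1/8 * 1/2`.
  rcases le_total (padded x (j + 1)) (-1 / 2) with h | h
  · have := le_max_left (-padded x (j + 1)) 0
    nlinarith
  · have h4 : 1 / 2 ≤ hat (padded x (j + 1) + 1) := by
      unfold hat
      rw [add_sub_cancel_right]
      refine le_max_of_le_left ?_
      have : |padded x (j + 1)| ≤ 1 / 2 := abs_le.2 ⟨by linarith, by linarith⟩
      linarith
    have := le_max_right (-padded x (j + 1)) 0
    nlinarith

/-! ### The zero-chain property and the range of the chain. -/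

/-- The coordinates of `x` from the `a`-th on vanish. -/
def VanishesFrom {d : ℕ} (x : Vec d) (a : ℕ) : Prop := ∀ j : Fin d, a ≤ j → x j = 0

lemma VanishesFrom.mono {d : ℕ} {x : Vec d} {a b : ℕ} (h : VanishesFrom x a) (hab : a ≤ b) :
    VanishesFrom x b := fun j hj => h j (hab.trans hj)

lemma VanishesFrom.padded_succ {d : ℕ} {x : Vec d} {a : ℕ} (h : VanishesFrom x a) {j : ℕ}
    (hj : a ≤ j) : padded x (j + 1) = 0 := by
  by_cases hd : j < d
  · rw [padded_succ_of_lt x hd]; exact h _ hj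
  · simp [padded, hd]

/-- The tent `hat` is 1 at 1 and 0 at 0, so only the coupling to the preceding coordinate survives.
It vanishes as well when that coordinate is zero, which is the zero-chain property. -/
lemma VanishesFrom.chainPartial_eq {d : ℕ} {x : Vec d} {a : ℕ} (h : VanishesFrom x a) :
    chainPartial (padded x) a = -smoothStep (padded x a) := by
  unfold chainPartial
  rw [h.padded_succ le_rfl, hat_zero]
  norm_num [hat]

lemma VanishesFrom.chainGrad {d : ℕ} {x : Vec d} {a : ℕ} (h : VanishesFrom x a) :
    VanishesFrom (chainGrad x) (a + 1) := by
  intro j hj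
  change chainPartial (padded x) j = 0
  rw [(h.mono (show a ≤ j by omega)).chainPartial_eq]
  obtain ⟨i, hi⟩ : ∃ i, (j : ℕ) = i + 1 := ⟨j - 1, by omega⟩
  rw [hi, h.padded_succ (by omega), smoothStep_of_nonpos le_rfl, neg_zero]

lemma VanishesFrom.abs_chainGrad_le {d : ℕ} {x : Vec d} {j : Fin d} (h : VanishesFrom x j) :
    |_root_.chainGrad x j| ≤ 1 := by
  change |chainPartial (padded x) j| ≤ 1
  rw [h.chainPartial_eq, abs_neg, abs_of_nonneg (smoothStep_nonneg _)]
  exact smoothStep_le_one _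

lemma neg_le_chain {d : ℕ} (x : Vec d) : -(d + 1 : ℝ) ≤ chain d x := by
  unfold chain
  have h1 : -(d + 1 : ℝ) ≤ ∑ k ∈ Finset.range (d + 1),
      -(smoothStep (padded x k) * smoothStep (padded x (k + 1) + 1)) := by
    have := Finset.card_nsmul_le_sum (Finset.range (d + 1))
      (fun k => -(smoothStep (padded x k) * smoothStep (padded x (k + 1) + 1))) (-1)
      fun k _ => neg_le_neg (mul_le_one₀ (smoothStep_le_one _) (smoothStep_nonneg _)
        (smoothStep_le_one _))
    simpa using this
  have h2 : 0 ≤ ∑ k ∈ Finset.range d, halfSq (-padded x (k + 1)) :=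
    Finset.sum_nonneg fun k _ => halfSq_nonneg _
  linarith

lemma chain_zero_nonpos (d : ℕ) : chain d 0 ≤ 0 := by
  unfold chain
  have h2 : ∑ k ∈ Finset.range d, halfSq (-padded (0 : Vec d) (k + 1)) = 0 :=
    Finset.sum_eq_zero fun k _ => by
      have : VanishesFrom (0 : Vec d) 0 := fun j _ => rfl
      rw [this.padded_succ (Nat.zero_le k)]
      simp [halfSq]
  rw [h2, add_zero]
  exact Finset.sum_nonpos fun k _ =>
    neg_nonpos.2 (mul_nonneg (smoothStep_nonneg _) (smoothStep_nonneg _))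

/-! ### Rescaling. -/

/-- The function `x ↦ L λ² / 5 * chain (x / λ)`. -/
noncomputable def scaledChain (d : ℕ) (L lam : ℝ) (x : Vec d) : ℝ :=
  L * lam ^ 2 / 5 * chain d (lam⁻¹ • x)

/-- The gradient of `scaledChain`. -/
noncomputable def scaledChainGrad {d : ℕ} (L lam : ℝ) (x : Vec d) : Vec d :=
  (L * lam / 5) • chainGrad (lam⁻¹ • x)

lemma hasGradientAt_scaledChain {d : ℕ} (L : ℝ) {lam : ℝ} (hlam : 0 < lam) (x : Vec d) :
    HasGradientAt (scaledChain d L lam) (scaledChainGrad L lam x) x := by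
  have h1 := (hasGradientAt_iff_hasFDerivAt.1 (hasGradientAt_chain (lam⁻¹ • x)))
  have h2 : HasFDerivAt (fun y : Vec d => lam⁻¹ • y) (lam⁻¹ • ContinuousLinearMap.id ℝ (Vec d)) x :=
    (hasFDerivAt_id x).const_smul lam⁻¹
  rw [hasGradientAt_iff_hasFDerivAt]
  refine ((h1.comp x h2).const_mul (L * lam ^ 2 / 5)).congr_fderiv ?_
  ext v
  simp only [scaledChainGrad, map_smul, smul_apply, ContinuousLinearMap.comp_apply,
    smul_eq_mul, ContinuousLinearMap.id_apply]
  simp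
  field_simp

lemma gradient_scaledChain {d : ℕ} (L : ℝ) {lam : ℝ} (hlam : 0 < lam) (x : Vec d) :
    gradient (scaledChain d L lam) x = scaledChainGrad L lam x :=
  (hasGradientAt_scaledChain L hlam x).gradient

lemma norm_scaledChainGrad_sub_le {d : ℕ} {L lam : ℝ} (hL : 0 < L) (hlam : 0 < lam)
    (x y : Vec d) : ‖scaledChainGrad L lam x - scaledChainGrad L lam y‖ ≤ L * ‖x - y‖ := by
  rw [scaledChainGrad, scaledChainGrad, ← smul_sub, norm_smul, Real.norm_of_nonneg (by positivity)]
  have h := norm_chainGrad_sub_le (lam⁻¹ • x) (lam⁻¹ • y)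
  rw [← smul_sub, norm_smul, Real.norm_of_nonneg (by positivity)] at h
  calc L * lam / 5 * _ ≤ L * lam / 5 * (5 * (lam⁻¹ * ‖x - y‖)) := by gcongr
    _ = L * ‖x - y‖ := by field_simp

lemma isLSmooth_scaledChain {d : ℕ} {L lam : ℝ} (hL : 0 < L) (hlam : 0 < lam) :
    IsLSmooth L (scaledChain d L lam) := by
  refine ⟨fun x => (hasGradientAt_scaledChain L hlam x).differentiableAt, fun x y => ?_⟩
  rw [gradient_scaledChain L hlam, gradient_scaledChain L hlam]
  exact norm_scaledChainGrad_sub_le hL hlam x y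

lemma continuous_scaledChainGrad {d : ℕ} {L lam : ℝ} (hL : 0 < L) (hlam : 0 < lam) :
    Continuous (scaledChainGrad (d := d) L lam) :=
  (LipschitzWith.of_dist_le_mul (K := ⟨L, hL.le⟩) fun x y => by
    rw [dist_eq_norm, dist_eq_norm]; exact norm_scaledChainGrad_sub_le hL hlam x y).continuous

lemma le_norm_scaledChainGrad {d : ℕ} {L lam : ℝ} (hL : 0 < L) (hlam : 0 < lam)
    (x : Vec (d + 1)) (hx : x (Fin.last d) = 0) :
    L * lam / 80 ≤ ‖scaledChainGrad L lam x‖ := by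
  rw [scaledChainGrad, norm_smul, Real.norm_of_nonneg (by positivity)]
  have h := le_norm_chainGrad (lam⁻¹ • x) (by simp [hx])
  have : 0 < L * lam := by positivity
  nlinarith

lemma VanishesFrom.smul {d : ℕ} {x : Vec d} {a : ℕ} (h : VanishesFrom x a) (r : ℝ) :
    VanishesFrom (r • x) a := fun j hj => by simp [h j hj]

lemma VanishesFrom.scaledChainGrad {d : ℕ} {x : Vec d} {a : ℕ} (h : VanishesFrom x a)
    (L lam : ℝ) : VanishesFrom (scaledChainGrad L lam x) (a + 1) :=
  (h.smul _).chainGrad.smul _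

lemma VanishesFrom.abs_scaledChainGrad_le {d : ℕ} {x : Vec d} {j : Fin d}
    (h : VanishesFrom x j) {L lam : ℝ} (hL : 0 < L) (hlam : 0 < lam) :
    |_root_.scaledChainGrad L lam x j| ≤ L * lam / 5 := by
  have h1 := (h.smul lam⁻¹).abs_chainGrad_le
  have h0 : 0 ≤ L * lam / 5 := by positivity
  change |(L * lam / 5) * _root_.chainGrad (lam⁻¹ • x) j| ≤ _
  rw [abs_mul, abs_of_nonneg h0]
  exact mul_le_of_le_one_right h0 h1

lemma neg_le_scaledChain {d : ℕ} {L : ℝ} (hL : 0 < L) (lam : ℝ) (x : Vec d) :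
    -(L * lam ^ 2 / 5 * (d + 1)) ≤ scaledChain d L lam x := by
  rw [scaledChain, ← mul_neg]
  exact mul_le_mul_of_nonneg_left (neg_le_chain _) (by positivity)

lemma bddBelow_scaledChain {d : ℕ} {L : ℝ} (hL : 0 < L) (lam : ℝ) :
    BddBelow (Set.range (scaledChain d L lam)) :=
  ⟨_, Set.forall_mem_range.2 (neg_le_scaledChain hL lam)⟩

lemma scaledChain_zero_sub_iInf_le {d : ℕ} {L : ℝ} (hL : 0 < L) (lam : ℝ) :
    scaledChain d L lam 0 - ⨅ x, scaledChain d L lam x ≤ L * lam ^ 2 / 5 * (d + 1) := by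
  have h1 : scaledChain d L lam 0 ≤ 0 := by
    rw [scaledChain, smul_zero]
    exact mul_nonpos_of_nonneg_of_nonpos (by positivity) (chain_zero_nonpos d)
  have h2 := le_ciInf (neg_le_scaledChain (d := d) hL lam)
  linarith

/-! ### The stochastic gradient oracle. -/

/-- The Bernoulli distribution on `Bool` with success probability `q`. -/
noncomputable def coin (q : ℝ) : Measure Bool :=
  ENNReal.ofReal q • Measure.dirac true + ENNReal.ofReal (1 - q) • Measure.dirac false

lemma isProbabilityMeasure_coin {q : ℝ} (h0 : 0 ≤ q) (h1 : q ≤ 1) :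
    IsProbabilityMeasure (coin q) := by
  constructor
  rw [coin]
  simp only [Measure.add_apply, Measure.smul_apply, measure_univ, smul_eq_mul, mul_one]
  rw [← ENNReal.ofReal_add h0 (by linarith)]
  simp

lemma coin_true (q : ℝ) : coin q {true} = ENNReal.ofReal q := by
  simp [coin]

lemma lintegral_coin (q : ℝ) (h : Bool → ENNReal) :
    ∫⁻ b, h b ∂coin q = ENNReal.ofReal q * h true + ENNReal.ofReal (1 - q) * h false := by
  simp [coin]

lemma integral_coin {d : ℕ} {q : ℝ} (h0 : 0 ≤ q) (h1 : q ≤ 1) (h : Bool → Vec d) :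
    ∫ b, h b ∂coin q = q • h true + (1 - q) • h false := by
  rw [coin, integral_add_measure]
  · simp [integral_smul_measure, ENNReal.toReal_ofReal h0, ENNReal.toReal_ofReal (sub_nonneg.2 h1)]
  · exact (integrable_dirac (by simp)).smul_measure ENNReal.ofReal_ne_top
  · exact (integrable_dirac (by simp)).smul_measure ENNReal.ofReal_ne_top

open Classical in
/-- The estimator of `g` whose coordinates beyond the support of the query point are revealed with
probability `q` only. -/
noncomputable def maskedEstimator {d : ℕ} (g : Vec d → Vec d) (q : ℝ) (x : Vec d) (b : Bool) :
    Vec d :=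
  WithLp.toLp 2 fun j => if VanishesFrom x j then (if b then q⁻¹ else 0) * g x j else g x j

open Classical in
/-- The part of `g x` that `maskedEstimator` hides. -/
noncomputable def maskedPart {d : ℕ} (g : Vec d → Vec d) (x : Vec d) : Vec d :=
  WithLp.toLp 2 fun j => if VanishesFrom x j then g x j else 0

/-- The error is a centered scalar variable times a fixed vector, which reduces the moment bound to
a Bernoulli computation. -/
lemma maskedEstimator_sub {d : ℕ} (g : Vec d → Vec d) (q : ℝ) (x : Vec d) (b : Bool) :
    maskedEstimator g q x b - g x = ((if b then q⁻¹ else 0) - 1) • maskedPart g x := by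
  ext j
  by_cases h : VanishesFrom x j <;> simp [maskedEstimator, maskedPart, h, sub_mul]

/-- At most one hidden coordinate is nonzero: if `x` vanishes from `i` on, then `g x` vanishes
beyond `i`. Hence the bound does not grow with the dimension. -/
lemma norm_maskedPart_le {d : ℕ} {g : Vec d → Vec d} {β : ℝ} (hβ : 0 ≤ β) {x : Vec d}
    (hg : ∀ a, VanishesFrom x a → VanishesFrom (g x) (a + 1))
    (hb : ∀ j : Fin d, VanishesFrom x j → |g x j| ≤ β) : ‖maskedPart g x‖ ≤ β := by
  have hne : ∀ j, maskedPart g x j ≠ 0 → VanishesFrom x j ∧ g x j ≠ 0 := by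
    intro j hj
    by_cases h : VanishesFrom x j
    · exact ⟨h, by simpa [maskedPart, h] using hj⟩
    · simp [maskedPart, h] at hj
  by_cases hex : ∃ j, maskedPart g x j ≠ 0
  · obtain ⟨j, hj⟩ := hex
    refine le_of_sq_le_sq ?_ hβ
    rw [EuclideanSpace.norm_sq_eq, Finset.sum_eq_single j]
    · refine pow_le_pow_left₀ (norm_nonneg _) ?_ 2
      simpa [maskedPart, (hne j hj).1] using hb j (hne j hj).1
    · intro i _ hij
      by_contra hi
      have hi' : maskedPart g x i ≠ 0 := by
        intro h0; apply hi; rw [h0]; simp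
      have h1 := hne i hi'
      have h2 := hne j hj
      rcases lt_or_gt_of_ne (Fin.val_ne_of_ne hij) with h | h
      · exact h2.2 (hg _ h1.1 j h)
      · exact h1.2 (hg _ h2.1 i h)
    · simp
  · push Not at hex
    have : maskedPart g x = 0 := by ext j; exact hex j
    rw [this, norm_zero]; exact hβ

lemma VanishesFrom.maskedEstimator {d : ℕ} {g : Vec d → Vec d} {q : ℝ} {x : Vec d} {a : ℕ}
    {b : Bool} (h : VanishesFrom (g x) a) : VanishesFrom (maskedEstimator g q x b) a := by
  intro j hj
  simp [_root_.maskedEstimator, h j hj]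

lemma VanishesFrom.maskedEstimator_false {d : ℕ} {g : Vec d → Vec d} {q : ℝ} {x : Vec d} {a : ℕ}
    (h : VanishesFrom x a) : VanishesFrom (_root_.maskedEstimator g q x false) a := by
  intro j hj
  simp [_root_.maskedEstimator, h.mono hj]

lemma measurableSet_vanishesFrom (d a : ℕ) : MeasurableSet {x : Vec d | VanishesFrom x a} := by
  have : {x : Vec d | VanishesFrom x a} = ⋂ (j : Fin d) (_ : a ≤ j), {x : Vec d | x j = 0} := by
    ext x; simp [VanishesFrom]
  rw [this]
  exact MeasurableSet.iInter fun j => MeasurableSet.iInter fun _ =>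
    (isClosed_eq (by fun_prop) continuous_const).measurableSet

lemma measurable_maskedEstimator {d : ℕ} {g : Vec d → Vec d} (hg : Continuous g) (q : ℝ) :
    Measurable (Function.uncurry (maskedEstimator g q)) := by
  classical
  refine (PiLp.continuous_toLp 2 _).measurable.comp (measurable_pi_lambda _ fun j => ?_)
  have hgj : Measurable fun z : Vec d × Bool => g z.1 j := by
    have : Continuous fun x : Vec d => g x j := by fun_prop
    exact this.measurable.comp measurable_fst
  refine Measurable.ite (measurable_fst (measurableSet_vanishesFrom d j)) ?_ hgj
  refine Measurable.mul ?_ hgj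
  exact (Measurable.of_discrete (f := fun b : Bool => if b then q⁻¹ else 0)).comp measurable_snd

/-- Each outcome contributes at most `β ^ p / q ^ (p - 1)`, whence the factor 2. For `q = 1` there
is no noise and no condition is needed. -/
lemma coin_moment_le {p q σ β : ℝ} (hp : 1 < p) (hq0 : 0 < q) (hq1 : q ≤ 1) (hβ : 0 ≤ β)
    (hσ : 0 < σ) (h : q < 1 → 2 * β ^ p ≤ σ ^ p * q ^ (p - 1)) :
    q * ((q⁻¹ - 1) * β) ^ p + (1 - q) * β ^ p ≤ σ ^ p := by
  have hinv : 1 ≤ q⁻¹ := (one_le_inv₀ hq0).2 hq1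
  rcases hq1.lt_or_eq with hlt | rfl
  · have h1 : (q⁻¹ - 1) ^ p ≤ (q⁻¹) ^ p :=
      Real.rpow_le_rpow (by linarith) (by linarith) (by linarith)
    have h2 : q * (q⁻¹) ^ p = (q ^ (p - 1))⁻¹ := by
      rw [Real.inv_rpow hq0.le, Real.rpow_sub_one hq0.ne', inv_div, div_eq_mul_inv]
    have hpos : 0 < q ^ (p - 1) := Real.rpow_pos_of_pos hq0 _
    have h3 : 1 ≤ (q ^ (p - 1))⁻¹ :=
      (one_le_inv₀ hpos).2 (Real.rpow_le_one hq0.le hq1 (by linarith))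
    have hβp : 0 ≤ β ^ p := Real.rpow_nonneg hβ p
    rw [Real.mul_rpow (by linarith) hβ]
    calc q * ((q⁻¹ - 1) ^ p * β ^ p) + (1 - q) * β ^ p
        ≤ q * ((q⁻¹) ^ p * β ^ p) + (q ^ (p - 1))⁻¹ * β ^ p := by
          gcongr
          linarith
      _ = (q ^ (p - 1))⁻¹ * (2 * β ^ p) := by rw [← mul_assoc, h2]; ring
      _ ≤ (q ^ (p - 1))⁻¹ * (σ ^ p * q ^ (p - 1)) := by exact mul_le_mul_of_nonneg_left (h hlt) (by positivity)
      _ = σ ^ p := by field_simp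
  · simp only [inv_one, sub_self, zero_mul, add_zero, one_mul]
    rw [Real.zero_rpow (by linarith)]
    exact (Real.rpow_pos_of_pos hσ p).le

lemma isPBCMEstimator_maskedEstimator {d : ℕ} {f : Vec d → ℝ} {g : Vec d → Vec d}
    {p q σ β : ℝ} (hp : 1 < p) (hq0 : 0 < q) (hq1 : q ≤ 1) (hβ : 0 ≤ β) (hσ : 0 < σ)
    (hfg : ∀ x, gradient f x = g x) (hcont : Continuous g)
    (hg : ∀ x a, VanishesFrom x a → VanishesFrom (g x) (a + 1))
    (hb : ∀ x (j : Fin d), VanishesFrom x j → |g x j| ≤ β)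
    (h : q < 1 → 2 * β ^ p ≤ σ ^ p * q ^ (p - 1)) :
    IsPBCMEstimator (coin q) p σ f (maskedEstimator g q) := by
  have := isProbabilityMeasure_coin hq0.le hq1
  refine ⟨measurable_maskedEstimator hcont q, fun x => Integrable.of_finite, fun x => ?_,
    fun x => ?_⟩
  · rw [integral_coin hq0.le hq1, hfg]
    ext j
    by_cases hx : VanishesFrom x j
    · simp [maskedEstimator, hx, hq0.ne']
    · simp [maskedEstimator, hx]; ring
  · simp only [hfg]
    have hn := norm_maskedPart_le hβ (hg x) (hb x)
    have hinv : 1 ≤ q⁻¹ := (one_le_inv₀ hq0).2 hq1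
    have h1 : ‖maskedEstimator g q x true - g x‖ₑ ≤ ENNReal.ofReal ((q⁻¹ - 1) * β) := by
      rw [maskedEstimator_sub, ← ofReal_norm, norm_smul]
      refine ENNReal.ofReal_le_ofReal ?_
      rw [if_pos rfl, Real.norm_of_nonneg (by linarith)]
      exact mul_le_mul_of_nonneg_left hn (by linarith)
    have h2 : ‖maskedEstimator g q x false - g x‖ₑ ≤ ENNReal.ofReal β := by
      rw [maskedEstimator_sub, ← ofReal_norm, norm_smul]
      refine ENNReal.ofReal_le_ofReal ?_
      simpa using hn
    rw [lintegral_coin]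
    have hp0 : 0 ≤ p := by linarith
    have hnn : 0 ≤ (q⁻¹ - 1) * β := mul_nonneg (by linarith) hβ
    calc _ ≤ ENNReal.ofReal q * ENNReal.ofReal ((q⁻¹ - 1) * β) ^ p +
          ENNReal.ofReal (1 - q) * ENNReal.ofReal β ^ p := by gcongr
      _ = ENNReal.ofReal (q * ((q⁻¹ - 1) * β) ^ p + (1 - q) * β ^ p) := by
          rw [ENNReal.ofReal_rpow_of_nonneg hnn hp0, ENNReal.ofReal_rpow_of_nonneg hβ hp0,
            ← ENNReal.ofReal_mul hq0.le, ← ENNReal.ofReal_mul (by linarith), ENNReal.ofReal_add]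
          · exact mul_nonneg hq0.le (Real.rpow_nonneg hnn p)
          · exact mul_nonneg (by linarith) (Real.rpow_nonneg hβ p)
      _ ≤ ENNReal.ofReal (σ ^ p) :=
          ENNReal.ofReal_le_ofReal (coin_moment_le hp hq0 hq1 hβ hσ h)

/-! ### Counting the deliveries of each worker. -/

namespace AsyncAlgorithm

variable {n d : ℕ} {Ξ : Type}

lemma run_congr (A : AsyncAlgorithm n d) (τ : Fin n → ℝ) (G : Vec d → Ξ → Vec d) {ω ω' : ℕ → Ξ}
    {k : ℕ} (h : ∀ i < k, ω i = ω' i) : A.run τ G ω k = A.run τ G ω' k := by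
  induction k with
  | zero => rfl
  | succ k ih =>
    simp only [run]
    rw [ih fun i hi => h i (by omega), h k (by omega)]

lemma clock_le_succ (A : AsyncAlgorithm n d) (τ : Fin n → ℝ) (G : Vec d → Ξ → Vec d) (ω : ℕ → Ξ)
    (k : ℕ) : A.clock τ G ω k ≤ A.clock τ G ω (k + 1) := by
  cases k with
  | zero => exact A.time_nonneg _
  | succ k =>
    have h := A.time_mono k (A.run τ G ω (k + 1)).grads
    have e : (fun s : Fin k => (A.run τ G ω (k + 1)).grads s.castSucc) = (A.run τ G ω k).grads := by
      funext s
      simp [run]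
    rw [e] at h
    exact h

lemma clock_mono (A : AsyncAlgorithm n d) (τ : Fin n → ℝ) (G : Vec d → Ξ → Vec d) (ω : ℕ → Ξ) :
    Monotone (A.clock τ G ω) :=
  monotone_nat_of_le_succ (A.clock_le_succ τ G ω)

/-- At round `k`, worker `i` returns a stochastic gradient. -/
def Delivers (A : AsyncAlgorithm n d) (τ : Fin n → ℝ) (G : Vec d → Ξ → Vec d) (ω : ℕ → Ξ)
    (k : ℕ) (i : Fin n) : Prop :=
  (A.step k (A.run τ G ω k).grads).worker = i ∧ ((A.run τ G ω k).workers i).busy = true ∧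
    ((A.run τ G ω k).workers i).startTime + τ i ≤ A.clock τ G ω (k + 1)

lemma clock_succ_congr (A : AsyncAlgorithm n d) (τ : Fin n → ℝ) (G : Vec d → Ξ → Vec d)
    {ω ω' : ℕ → Ξ} {k : ℕ} (h : ∀ i < k, ω i = ω' i) :
    A.clock τ G ω (k + 1) = A.clock τ G ω' (k + 1) := by
  simp only [clock, A.run_congr τ G h]

/-- Whether round `k` delivers is settled before the sample `ω k` is used; this makes the sample
independent of the delivery. -/
lemma delivers_congr (A : AsyncAlgorithm n d) (τ : Fin n → ℝ) (G : Vec d → Ξ → Vec d)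
    {ω ω' : ℕ → Ξ} {k : ℕ} (h : ∀ i < k, ω i = ω' i) (i : Fin n) :
    A.Delivers τ G ω k i ↔ A.Delivers τ G ω' k i := by
  simp only [Delivers, A.run_congr τ G h, A.clock_succ_congr τ G h]

/-- The three possible effects of an oracle call: the worker starts, is still busy, or delivers. -/
lemma run_succ_cases (A : AsyncAlgorithm n d) (τ : Fin n → ℝ) (G : Vec d → Ξ → Vec d) (ω : ℕ → Ξ)
    (k : ℕ) :
    ∃ i, (∃ w v, (A.run τ G ω (k + 1)) =
        ⟨Fin.snoc (α := fun _ => Vec d) (A.run τ G ω k).grads v,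
          Function.update (A.run τ G ω k).workers i w⟩ ∧
      ((w = ⟨A.clock τ G ω (k + 1), A.iterate τ G ω k, true⟩ ∧ v = 0 ∧
          ∀ j, ¬ A.Delivers τ G ω k j) ∨
        (w = (A.run τ G ω k).workers i ∧ v = 0 ∧ ∀ j, ¬ A.Delivers τ G ω k j) ∨
        (w = WorkerState.idle d ∧ v = G ((A.run τ G ω k).workers i).point (ω k) ∧
          A.Delivers τ G ω k i))) := by
  set i := (A.step k (A.run τ G ω k).grads).worker with hi
  set o := timeOracle G (τ i) (A.step k (A.run τ G ω k).grads).time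
    (A.step k (A.run τ G ω k).grads).point ((A.run τ G ω k).workers i) (ω k) with ho
  refine ⟨i, o.1, o.2, rfl, ?_⟩
  by_cases h1 : ((A.run τ G ω k).workers i).busy = false
  · left
    refine ⟨by rw [ho, timeOracle, if_pos h1]; rfl, by rw [ho, timeOracle, if_pos h1], ?_⟩
    rintro j ⟨rfl, h, -⟩
    rw [← hi, h1] at h
    exact Bool.false_ne_true h
  · right
    by_cases h2 : (A.step k (A.run τ G ω k).grads).time <
        ((A.run τ G ω k).workers i).startTime + τ i
    · left
      have hb : ((A.run τ G ω k).workers i).busy = true := by simpa using h1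
      refine ⟨?_, by rw [ho, timeOracle, if_neg h1, if_pos h2], ?_⟩
      · rw [ho, timeOracle, if_neg h1, if_pos h2]
        simp only
        rw [← hb]
      · rintro j ⟨rfl, -, h⟩
        exact absurd h (not_le.2 h2)
    · right
      refine ⟨by rw [ho, timeOracle, if_neg h1, if_neg h2],
        by rw [ho, timeOracle, if_neg h1, if_neg h2], rfl, by simpa using h1, not_lt.1 h2⟩

open Classical in
/-- The number of stochastic gradients that worker `i` has returned in the first `k` rounds. -/
noncomputable def deliveries (A : AsyncAlgorithm n d) (τ : Fin n → ℝ) (G : Vec d → Ξ → Vec d)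
    (ω : ℕ → Ξ) (i : Fin n) (k : ℕ) : ℕ :=
  ((Finset.range k).filter fun m => A.Delivers τ G ω m i).card

/-- A worker handles one request at a time, so its computations occupy disjoint intervals of length
at least `τ i`. The clause on busy workers carries the induction: earlier deliveries fit before the
current start time. -/
lemma deliveries_mul_le (A : AsyncAlgorithm n d) (τ : Fin n → ℝ) (G : Vec d → Ξ → Vec d)
    (ω : ℕ → Ξ) (i : Fin n) (k : ℕ) :
    A.deliveries τ G ω i k * τ i ≤ A.clock τ G ω k ∧
      (((A.run τ G ω k).workers i).busy = true →
        A.deliveries τ G ω i k * τ i ≤ ((A.run τ G ω k).workers i).startTime) := by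
  classical
  induction k with
  | zero => simp [deliveries, clock, run, WorkerState.idle]
  | succ k ih =>
    have hclock := A.clock_le_succ τ G ω k
    have hsame : ¬ A.Delivers τ G ω k i →
        A.deliveries τ G ω i (k + 1) = A.deliveries τ G ω i k := by
      intro h
      rw [deliveries, Finset.range_add_one, Finset.filter_insert, if_neg h]
      rfl
    have hnext : A.Delivers τ G ω k i →
        A.deliveries τ G ω i (k + 1) = A.deliveries τ G ω i k + 1 := by
      intro h
      rw [deliveries, Finset.range_add_one, Finset.filter_insert, if_pos h,
        Finset.card_insert_of_notMem (by simp)]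
      rfl
    obtain ⟨i', w, v, hrun, h | h | h⟩ := A.run_succ_cases τ G ω k
    · rw [hsame (h.2.2 i)]
      refine ⟨ih.1.trans hclock, fun hb => ?_⟩
      rw [hrun] at hb ⊢
      by_cases hi : i = i'
      · subst hi
        simp only [Function.update_self, h.1]
        exact ih.1.trans hclock
      · simp only [Function.update_of_ne hi] at hb ⊢
        exact ih.2 hb
    · rw [hsame (h.2.2 i)]
      refine ⟨ih.1.trans hclock, fun hb => ?_⟩
      rw [hrun, h.1, Function.update_eq_self] at hb ⊢
      exact ih.2 hb
    · by_cases hi : i = i'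
      · subst hi
        rw [hnext h.2.2]
        refine ⟨?_, fun hb => ?_⟩
        · have h1 := ih.2 h.2.2.2.1
          have h2 := h.2.2.2.2
          push_cast
          linarith
        · rw [hrun, h.1] at hb
          simp [WorkerState.idle] at hb
      · rw [hsame fun hd => hi (hd.1.symm.trans h.2.2.1)]
        refine ⟨ih.1.trans hclock, fun hb => ?_⟩
        rw [hrun] at hb ⊢
        simp only [Function.update_of_ne hi] at hb ⊢
        exact ih.2 hb

open Classical in
lemma card_delivers_mul_le (A : AsyncAlgorithm n d) (τ : Fin n → ℝ) (G : Vec d → Ξ → Vec d)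
    (ω : ℕ → Ξ) {i : Fin n} (hτ : 0 ≤ τ i) {t : ℝ} (ht : 0 ≤ t) (K : ℕ) :
    (((Finset.range K).filter fun m => A.Delivers τ G ω m i ∧ A.clock τ G ω (m + 1) ≤ t).card : ℝ)
      * τ i ≤ t := by
  induction K with
  | zero => simpa using ht
  | succ K ih =>
    by_cases h : A.clock τ G ω (K + 1) ≤ t
    · refine le_trans ?_ ((A.deliveries_mul_le τ G ω i (K + 1)).1.trans h)
      refine mul_le_mul_of_nonneg_right ?_ hτ
      refine Nat.cast_le.2 (Finset.card_le_card ?_)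
      exact Finset.monotone_filter_right _ fun _ _ hm => hm.1
    · rw [Finset.range_add_one, Finset.filter_insert, if_neg fun h' => h h'.2]
      exact ih

lemma tsum_delivers_le (A : AsyncAlgorithm n d) (τ : Fin n → ℝ) (G : Vec d → Ξ → Vec d)
    (ω : ℕ → Ξ) {i : Fin n} (hτ : 0 < τ i) {t : ℝ} (ht : 0 ≤ t) :
    ∑' k, ({ω | A.Delivers τ G ω k i ∧ A.clock τ G ω (k + 1) ≤ t}.indicator 1 ω : ENNReal) ≤
      ENNReal.ofReal (t / τ i) := by
  classical
  refine ENNReal.tsum_le_of_sum_range_le fun K => ?_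
  have h := A.card_delivers_mul_le τ G ω hτ.le ht K
  rw [← le_div_iff₀ hτ] at h
  have e : ∑ k ∈ Finset.range K,
      ({ω | A.Delivers τ G ω k i ∧ A.clock τ G ω (k + 1) ≤ t}.indicator 1 ω : ENNReal) =
      (((Finset.range K).filter fun m => A.Delivers τ G ω m i ∧ A.clock τ G ω (m + 1) ≤ t).card :
        ENNReal) := by
    rw [Finset.card_filter, Nat.cast_sum]
    refine Finset.sum_congr rfl fun k _ => ?_
    by_cases hk : A.Delivers τ G ω k i ∧ A.clock τ G ω (k + 1) ≤ t <;> simp [Set.indicator, hk]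
  rw [e, ← ENNReal.ofReal_natCast]
  exact ENNReal.ofReal_le_ofReal h

/-! ### The cost of uncovering a coordinate. -/

/-- At round `k`, a worker that needs time at most `s` returns a stochastic gradient. -/
def FastDelivers (A : AsyncAlgorithm n d) (τ : Fin n → ℝ) (G : Vec d → Ξ → Vec d) (s : ℝ)
    (ω : ℕ → Ξ) (k : ℕ) : Prop :=
  ∃ i, τ i ≤ s ∧ A.Delivers τ G ω k i

lemma tsum_fastDelivers_le (A : AsyncAlgorithm n d) {τ : Fin n → ℝ} (G : Vec d → Ξ → Vec d)
    (s : ℝ) (ω : ℕ → Ξ) (hτ : ∀ i, 0 < τ i) {t : ℝ} (ht : 0 ≤ t) :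
    ∑' k, ({ω | A.FastDelivers τ G s ω k ∧ A.clock τ G ω (k + 1) ≤ t}.indicator 1 ω : ENNReal) ≤
      ENNReal.ofReal (t * ∑ i with τ i ≤ s, 1 / τ i) := by
  have h : ∀ k, ({ω | A.FastDelivers τ G s ω k ∧ A.clock τ G ω (k + 1) ≤ t}.indicator 1 ω : ENNReal)
      ≤ ∑ i with τ i ≤ s,
        ({ω | A.Delivers τ G ω k i ∧ A.clock τ G ω (k + 1) ≤ t}.indicator 1 ω : ENNReal) := by
    intro k
    refine Set.indicator_apply_le' (fun hω => ?_) (fun _ => zero_le)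
    obtain ⟨⟨i, his, hi⟩, ht⟩ := hω
    have hmem : ω ∈ {ω | A.Delivers τ G ω k i ∧ A.clock τ G ω (k + 1) ≤ t} := ⟨hi, ht⟩
    refine le_trans (le_of_eq ?_) (Finset.single_le_sum (f := fun i =>
      ({ω | A.Delivers τ G ω k i ∧ A.clock τ G ω (k + 1) ≤ t}.indicator 1 ω : ENNReal))
      (fun _ _ => zero_le) (Finset.mem_filter.2 ⟨Finset.mem_univ i, his⟩))
    rw [Set.indicator_of_mem hmem]
  refine (ENNReal.tsum_le_tsum h).trans ?_
  rw [Summable.tsum_finsetSum fun i _ => ENNReal.summable, Finset.mul_sum,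
    ENNReal.ofReal_sum_of_nonneg fun i _ => mul_nonneg ht (one_div_nonneg.2 (hτ i).le)]
  refine Finset.sum_le_sum fun i _ => ?_
  rw [mul_one_div]
  exact A.tsum_delivers_le τ G ω (hτ i) ht

open Classical in
/-- The number of rounds before round `k` at which a fast worker returns a stochastic gradient
computed with a successful sample. -/
noncomputable def fastSuccesses (A : AsyncAlgorithm n d) (τ : Fin n → ℝ)
    (G : Vec d → Bool → Vec d) (s : ℝ) (ω : ℕ → Bool) (k : ℕ) : ℕ :=
  ((Finset.range k).filter fun m => A.FastDelivers τ G s ω m ∧ ω m = true).card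

lemma iterate_vanishesFrom (A : AsyncAlgorithm n d) (τ : Fin n → ℝ) (G : Vec d → Ξ → Vec d)
    (ω : ℕ → Ξ) {k l : ℕ} (h : ∀ m, VanishesFrom ((A.run τ G ω k).grads m) l) :
    VanishesFrom (A.iterate τ G ω k) l := by
  intro j hj
  by_contra hne
  obtain ⟨m, hm⟩ := A.support_subset k _ j hne
  exact hm (h m j hj)

/-- If the oracle reveals at most one new coordinate, and none with an unsuccessful sample, then
every newly revealed coordinate costs either a success of a fast worker or time `s`. -/
lemma exists_level (A : AsyncAlgorithm n d) {τ : Fin n → ℝ} {G : Vec d → Bool → Vec d}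
    (hG : ∀ x a b, VanishesFrom x a → VanishesFrom (G x b) (a + 1))
    (hG_false : ∀ x a, VanishesFrom x a → VanishesFrom (G x false) a) {s : ℝ} (hs : 0 ≤ s)
    (ω : ℕ → Bool) (k : ℕ) :
    ∃ (l : ℕ) (b : ℝ), (∀ m, VanishesFrom ((A.run τ G ω k).grads m) l) ∧
      b ≤ A.clock τ G ω k ∧ l * s ≤ A.fastSuccesses τ G s ω k * s + b ∧
      ∀ i, ((A.run τ G ω k).workers i).busy = true →
        VanishesFrom ((A.run τ G ω k).workers i).point l ∧
        ((∃ a < l, VanishesFrom ((A.run τ G ω k).workers i).point a) ∨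
          b ≤ ((A.run τ G ω k).workers i).startTime) := by
  -- Here `l` bounds the revealed coordinates and `b` is the time of the last slow discovery. A busy
  -- worker is either stale, its point not using coordinate `l - 1` and so unable to reveal a new
  -- one, or it started no earlier than `b`.
  classical
  induction k with
  | zero => exact ⟨0, 0, fun m => m.elim0, le_rfl, by simp [fastSuccesses],
      fun i hi => by simp [run, WorkerState.idle] at hi⟩
  | succ k ih =>
    obtain ⟨l, b, hg, hb, hl, hw⟩ := ih
    have hclock := A.clock_le_succ τ G ω k
    have hF : (A.fastSuccesses τ G s ω k : ℝ) ≤ A.fastSuccesses τ G s ω (k + 1) := by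
      exact_mod_cast Finset.card_le_card
        (Finset.filter_subset_filter _ (Finset.range_mono (Nat.le_succ k)))
    have hFs := mul_le_mul_of_nonneg_right hF hs
    have hx := A.iterate_vanishesFrom τ G ω hg
    obtain ⟨i', w, v, hrun, h | h | h⟩ := A.run_succ_cases τ G ω k
    · refine ⟨l, b, fun m => ?_, hb.trans hclock, by linarith, fun i => ?_⟩
      · rw [hrun]
        refine Fin.lastCases ?_ (fun m => ?_) m
        · simp only [Fin.snoc_last, h.2.1]
          exact fun j _ => rfl
        · simp only [Fin.snoc_castSucc]
          exact hg m
      · rw [hrun]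
        by_cases hi : i = i'
        · subst hi
          simp only [Function.update_self, h.1]
          exact fun _ => ⟨hx, Or.inr (hb.trans hclock)⟩
        · simp only [Function.update_of_ne hi]
          exact hw i
    · refine ⟨l, b, fun m => ?_, hb.trans hclock, by linarith, fun i => ?_⟩
      · rw [hrun]
        refine Fin.lastCases ?_ (fun m => ?_) m
        · simp only [Fin.snoc_last, h.2.1]
          exact fun j _ => rfl
        · simp only [Fin.snoc_castSucc]
          exact hg m
      · rw [hrun, h.1, Function.update_eq_self]
        exact hw i
    · obtain ⟨hwi, hv, hd⟩ := h
      obtain ⟨hp, hst⟩ := hw i' hd.2.1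
      have hgrads : ∀ l', l ≤ l' → VanishesFrom v l' →
          ∀ m, VanishesFrom ((A.run τ G ω (k + 1)).grads m) l' := by
        intro l' hl' hv' m
        rw [hrun]
        refine Fin.lastCases ?_ (fun m => ?_) m
        · simpa only [Fin.snoc_last] using hv'
        · simp only [Fin.snoc_castSucc]
          exact (hg m).mono hl'
      have hworkers : ∀ (P : WorkerState d → Prop),
          (∀ i, ((A.run τ G ω k).workers i).busy = true → P ((A.run τ G ω k).workers i)) →
          ∀ i, ((A.run τ G ω (k + 1)).workers i).busy = true →
            P ((A.run τ G ω (k + 1)).workers i) := by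
        intro P hP i
        rw [hrun]
        by_cases hi : i = i'
        · subst hi
          simp [hwi, WorkerState.idle]
        · simp only [Function.update_of_ne hi]
          exact hP i
      by_cases hvl : VanishesFrom v l
      · exact ⟨l, b, hgrads l le_rfl hvl, hb.trans hclock, by linarith, hworkers (fun w =>
          VanishesFrom w.point l ∧ ((∃ a < l, VanishesFrom w.point a) ∨ b ≤ w.startTime)) hw⟩
      · have hstale : ¬ ∃ a < l, VanishesFrom ((A.run τ G ω k).workers i').point a := by
          rintro ⟨a, ha, hpa⟩
          exact hvl (hv ▸ (hG _ a _ hpa).mono ha)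
        have hωk : ω k = true := by
          by_contra hne
          rw [Bool.not_eq_true] at hne
          exact hvl (by rw [hv, hne]; exact hG_false _ _ hp)
        have hbst := hst.resolve_left hstale
        have hvl' : VanishesFrom v (l + 1) := hv ▸ hG _ l _ hp
        -- Once the level rises, every computation still under way is stale, so `b` may be replaced
        -- by any value.
        have hstale' : ∀ b', ∀ i, ((A.run τ G ω (k + 1)).workers i).busy = true →
            VanishesFrom ((A.run τ G ω (k + 1)).workers i).point (l + 1) ∧
            ((∃ a < l + 1, VanishesFrom ((A.run τ G ω (k + 1)).workers i).point a) ∨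
              b' ≤ ((A.run τ G ω (k + 1)).workers i).startTime) := fun b' =>
          hworkers (fun w => VanishesFrom w.point (l + 1) ∧
              ((∃ a < l + 1, VanishesFrom w.point a) ∨ b' ≤ w.startTime))
            fun i hi => ⟨(hw i hi).1.mono (Nat.le_succ l), Or.inl ⟨l, Nat.lt_succ_self l, (hw i hi).1⟩⟩
        by_cases hfast : τ i' ≤ s
        · refine ⟨l + 1, b, hgrads _ (Nat.le_succ l) hvl', hb.trans hclock, ?_, hstale' b⟩
          have hnext : A.fastSuccesses τ G s ω (k + 1) = A.fastSuccesses τ G s ω k + 1 := by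
            rw [fastSuccesses, Finset.range_add_one, Finset.filter_insert,
              if_pos ⟨⟨i', hfast, hd⟩, hωk⟩, Finset.card_insert_of_notMem (by simp)]
            rfl
          rw [hnext]
          push_cast
          linarith
        -- A slow discovery moves `b` to the current time, an advance of more than `s` that pays for
        -- the new level.
        · refine ⟨l + 1, A.clock τ G ω (k + 1), hgrads _ (Nat.le_succ l) hvl', le_rfl, ?_,
            hstale' _⟩
          have := hd.2.2
          push_cast
          linarith

end AsyncAlgorithm

/-! ### Expected successes and the lower bound in expectation. -/

/-- An event that depends only on the first `k` coordinates is measurable and independent of the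
`k`-th coordinate. -/
lemma measure_inter_coordinate {D : Measure Bool} [IsProbabilityMeasure D] {k : ℕ}
    {E : Set (ℕ → Bool)} (hE : ∀ ω ω', (∀ i < k, ω i = ω' i) → ω ∈ E → ω' ∈ E) :
    MeasurableSet E ∧ Measure.infinitePi (fun _ : ℕ => D) (E ∩ {ω | ω k = true}) =
      Measure.infinitePi (fun _ : ℕ => D) E * D {true} := by
  set μ := Measure.infinitePi fun _ : ℕ => D
  set r : (ℕ → Bool) → (Finset.range k → Bool) := fun ω i => ω i with hr
  -- `E` is a cylinder over a finite discrete space, so its measurability needs no assumption on the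
  -- algorithm.
  have hpre : E = r ⁻¹' (r '' E) := by
    refine Set.Subset.antisymm (Set.subset_preimage_image r E) ?_
    rintro ω ⟨ω', hω', h⟩
    exact hE ω' ω (fun i hi => congrFun h ⟨i, Finset.mem_range.2 hi⟩) hω'
  have hrm : Measurable r := by fun_prop
  have hS : MeasurableSet (r '' E) := MeasurableSet.of_discrete
  refine ⟨hpre ▸ hrm hS, ?_⟩
  have hind := (ProbabilityTheory.iIndepFun_infinitePi (P := fun _ : ℕ => D)
    (X := fun _ b => b) fun _ => measurable_id).indepFun_finset (Finset.range k) {k}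
    (by simp) fun i => measurable_pi_apply i
  have hmul := hind.measure_inter_preimage_eq_mul (r '' E)
    ((fun z : ({k} : Finset ℕ) → Bool => z ⟨k, Finset.mem_singleton_self k⟩) ⁻¹' {true}) hS
    MeasurableSet.of_discrete
  have hk : μ {ω | ω k = true} = D {true} :=
    (measurePreserving_eval_infinitePi (fun _ : ℕ => D) k).measure_preimage
      (MeasurableSet.singleton true).nullMeasurableSet
  rw [← hk]
  conv_lhs => rw [hpre]
  conv_rhs => rw [hpre]
  exact hmul

namespace AsyncAlgorithm

variable {n d : ℕ}

lemma fastSuccesses_le_tsum (A : AsyncAlgorithm n d) (τ : Fin n → ℝ) (G : Vec d → Bool → Vec d)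
    (s : ℝ) {t : ℝ} (ω : ℕ → Bool) {k : ℕ} (hk : A.clock τ G ω k ≤ t) :
    (A.fastSuccesses τ G s ω k : ENNReal) ≤
      ∑' m, (({ω | A.FastDelivers τ G s ω m ∧ A.clock τ G ω (m + 1) ≤ t} ∩
        {ω | ω m = true}).indicator 1 ω : ENNReal) := by
  classical
  refine le_trans (le_of_eq ?_) (ENNReal.sum_le_tsum (Finset.range k))
  rw [fastSuccesses, Finset.card_filter, Nat.cast_sum]
  refine Finset.sum_congr rfl fun m hm => ?_
  have hc : A.clock τ G ω (m + 1) ≤ t :=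
    (A.clock_mono τ G ω (Finset.mem_range.1 hm)).trans hk
  by_cases h : A.FastDelivers τ G s ω m ∧ ω m = true
  · simp [Set.indicator, h, hc]
  · have h' : ω ∉ {ω | A.FastDelivers τ G s ω m ∧ A.clock τ G ω (m + 1) ≤ t} ∩ {ω | ω m = true} :=
      fun h' => h ⟨h'.1.1, h'.2⟩
    rw [if_neg h, Set.indicator_of_notMem h', Nat.cast_zero]

/-- If the workers that need time at most `s` return at most one successful stochastic gradient
per time `s` on average, then all iterates up to a quarter of the time `s * dim` have last
coordinate zero with probability at least `1 / 2`. -/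
lemma ofReal_le_expectedMinGrad (A : AsyncAlgorithm n (d + 1)) {τ : Fin n → ℝ} (hτ : ∀ i, 0 < τ i)
    {G : Vec (d + 1) → Bool → Vec (d + 1)}
    (hG : ∀ x a b, VanishesFrom x a → VanishesFrom (G x b) (a + 1))
    (hG_false : ∀ x a, VanishesFrom x a → VanishesFrom (G x false) a)
    {q s : ℝ} (hq0 : 0 ≤ q) (hq1 : q ≤ 1) (hs : 0 < s)
    (hrate : q * s * ∑ i with τ i ≤ s, 1 / τ i ≤ 1) {f : Vec (d + 1) → ℝ} {γ : ℝ}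
    (hγ : ∀ x : Vec (d + 1), x (Fin.last d) = 0 → γ ≤ ‖gradient f x‖)
    {t : ℝ} (ht : t ≤ s * (d + 1) / 4) :
    ENNReal.ofReal (γ / 2) ≤ A.expectedMinGrad τ (coin q) G f t := by
  have := isProbabilityMeasure_coin hq0 hq1
  set μ := Measure.infinitePi fun _ : ℕ => coin q with hμ
  -- The counting uses the full horizon `t'`, which is nonnegative, while `t` may be negative.
  set t' := s * (d + 1) / 4 with ht'
  have ht0 : 0 ≤ t' := by positivity
  set E : ℕ → Set (ℕ → Bool) := fun m =>
    {ω | A.FastDelivers τ G s ω m ∧ A.clock τ G ω (m + 1) ≤ t'} with hE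
  have hEk : ∀ m, MeasurableSet (E m) ∧ μ (E m ∩ {ω | ω m = true}) = μ (E m) * coin q {true} := by
    refine fun m => measure_inter_coordinate fun ω ω' h hω => ?_
    obtain ⟨⟨i, hi, hd⟩, hc⟩ := hω
    exact ⟨⟨i, hi, (A.delivers_congr τ G h i).1 hd⟩, (A.clock_succ_congr τ G h) ▸ hc⟩
  have hmeas : ∀ m, MeasurableSet (E m ∩ {ω | ω m = true}) := fun m =>
    (hEk m).1.inter (measurableSet_eq_fun (measurable_pi_apply m) measurable_const)
  set M : (ℕ → Bool) → ENNReal := fun ω =>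
    ∑' m, (E m ∩ {ω | ω m = true}).indicator 1 ω with hM
  have hMm : Measurable M :=
    Measurable.tsum fun m => measurable_one.indicator (hmeas m)
  have hint : ∫⁻ ω, M ω ∂μ ≤ ENNReal.ofReal ((d + 1) / 4) := by
    calc ∫⁻ ω, M ω ∂μ = ∑' m, μ (E m ∩ {ω | ω m = true}) := by
          rw [lintegral_tsum fun m => (measurable_one.indicator (hmeas m)).aemeasurable]
          exact tsum_congr fun m => lintegral_indicator_one (hmeas m)
      _ = (∑' m, μ (E m)) * ENNReal.ofReal q := by
          rw [← ENNReal.tsum_mul_right]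
          exact tsum_congr fun m => by rw [(hEk m).2, coin_true]
      _ = (∫⁻ ω, ∑' m, (E m).indicator 1 ω ∂μ) * ENNReal.ofReal q := by
          rw [lintegral_tsum fun m => (measurable_one.indicator (hEk m).1).aemeasurable]
          congr 1
          exact tsum_congr fun m => (lintegral_indicator_one (hEk m).1).symm
      _ ≤ (∫⁻ _, ENNReal.ofReal (t' * ∑ i with τ i ≤ s, 1 / τ i) ∂μ) * ENNReal.ofReal q := by
          gcongr with ω
          exact A.tsum_fastDelivers_le G s ω hτ ht0
      _ = ENNReal.ofReal ((t' * ∑ i with τ i ≤ s, 1 / τ i) * q) := by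
          rw [lintegral_const, measure_univ, mul_one, ENNReal.ofReal_mul' hq0]
      _ ≤ ENNReal.ofReal ((d + 1) / 4) := by
          refine ENNReal.ofReal_le_ofReal ?_
          calc (t' * ∑ i with τ i ≤ s, 1 / τ i) * q
              = (d + 1) / 4 * (q * s * ∑ i with τ i ≤ s, 1 / τ i) := by rw [ht']; ring
            _ ≤ (d + 1) / 4 := mul_le_of_le_one_right (by positivity) hrate
  set bad : Set (ℕ → Bool) := {ω | ENNReal.ofReal ((d + 1) / 2) ≤ M ω} with hbad
  have hbadm : MeasurableSet bad := measurableSet_le measurable_const hMm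
  have hPbad : μ bad ≤ 2⁻¹ := by
    refine (meas_ge_le_lintegral_div hMm.aemeasurable ?_ ENNReal.ofReal_ne_top).trans ?_
    · rw [Ne, ENNReal.ofReal_eq_zero, not_le]; positivity
    · refine ENNReal.div_le_of_le_mul (hint.trans (le_of_eq ?_))
      rw [← ENNReal.ofReal_ofNat, ← ENNReal.ofReal_inv_of_pos (by norm_num),
        ← ENNReal.ofReal_mul (by norm_num)]
      congr 1
      ring
  have hPgood : 2⁻¹ ≤ μ badᶜ := by
    rw [prob_compl_eq_one_sub hbadm]
    refine le_trans (le_of_eq ?_) (tsub_le_tsub_left hPbad 1)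
    exact ENNReal.one_sub_inv_two.symm
  have hgood : ∀ ω ∈ badᶜ, ∀ k, A.clock τ G ω k ≤ t →
      ENNReal.ofReal γ ≤ ‖gradient f (A.iterate τ G ω k)‖ₑ := by
    intro ω hω k hk
    have hk' := hk.trans ht
    have hF := (A.fastSuccesses_le_tsum τ G s ω hk').trans_lt (not_le.1 hω)
    rw [← ENNReal.ofReal_natCast, ENNReal.ofReal_lt_ofReal_iff (by positivity)] at hF
    obtain ⟨l, b, hg, hb, hl, -⟩ := A.exists_level (τ := τ) hG hG_false hs.le ω k
    -- Fewer than `(d + 1) / 2` levels come from successes and at most `(d + 1) / 4` from elapsed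
    -- time.
    have hld : l ≤ d := by
      by_contra hcon
      have h1 : (d : ℝ) + 1 ≤ l := by exact_mod_cast not_le.1 hcon
      have h2 := mul_le_mul_of_nonneg_right h1 hs.le
      have h3 := mul_lt_mul_of_pos_right hF hs
      have h4 : 0 < s * (d + 1) := by positivity
      linarith
    rw [← ofReal_norm]
    exact ENNReal.ofReal_le_ofReal (hγ _ (A.iterate_vanishesFrom τ G ω hg (Fin.last d) hld))
  calc ENNReal.ofReal (γ / 2) = ENNReal.ofReal γ * 2⁻¹ := by
        rw [← ENNReal.ofReal_ofNat, ← ENNReal.ofReal_inv_of_pos (by norm_num),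
          ← ENNReal.ofReal_mul' (by norm_num), div_eq_mul_inv]
    _ ≤ ENNReal.ofReal γ * μ badᶜ := by gcongr
    _ = ∫⁻ ω, badᶜ.indicator (fun _ => ENNReal.ofReal γ) ω ∂μ :=
        (lintegral_indicator_const hbadm.compl _).symm
    _ ≤ A.expectedMinGrad τ (coin q) G f t := by
        refine lintegral_mono fun ω => ?_
        refine Set.indicator_apply_le' (fun hω => ?_) (fun _ => zero_le)
        exact le_iInf₂ fun k hk => hgood ω hω k hk

end AsyncAlgorithm

/-! ### Choice of the time scale and the constants. -/

/-- By monotonicity the fast workers form an initial segment of some size `m`, with `S = ∑ 1 / τ i`.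
The hypothesis there reads `2 s S ≤ m + 1/q`, while fastness gives `m ≤ s S`; subtracting leaves `s
S ≤ 1/q`. -/
lemma rate_mul_sum_le_one {n : ℕ} {τ : Fin n → ℝ} (hτ : ∀ i, 0 < τ i) (hmono : Monotone τ)
    {q s : ℝ} (hq : 0 < q)
    (h : ∀ j : Fin n, 2 * s ≤ (1 / ((j : ℝ) + 1) * ∑ i ∈ Finset.Iic j, 1 / τ i)⁻¹ *
      (1 + 1 / (((j : ℝ) + 1) * q))) :
    q * s * ∑ i with τ i ≤ s, 1 / τ i ≤ 1 := by
  rcases (Finset.univ.filter fun i => τ i ≤ s).eq_empty_or_nonempty with he | hne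
  · rw [he]; simp
  · obtain ⟨j, hj, hmax⟩ := Finset.exists_max_image _ id hne
    have hjs : τ j ≤ s := (Finset.mem_filter.1 hj).2
    have hs : 0 < s := (hτ j).trans_le hjs
    have heq : (Finset.univ.filter fun i => τ i ≤ s) = Finset.Iic j := by
      ext i
      simp only [Finset.mem_filter, Finset.mem_univ, true_and, Finset.mem_Iic]
      exact ⟨fun hi => hmax i (by simpa using hi), fun hi => (hmono hi).trans hjs⟩
    rw [heq]
    have hj' := h j
    set S := ∑ i ∈ Finset.Iic j, 1 / τ i with hS
    have hm : (0 : ℝ) < (j : ℝ) + 1 := by positivity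
    have hlow : ((j : ℝ) + 1) ≤ S * s := by
      have : ∀ i ∈ Finset.Iic j, 1 / s ≤ 1 / τ i := fun i hi =>
        one_div_le_one_div_of_le (hτ i) ((hmono (Finset.mem_Iic.1 hi)).trans hjs)
      have h2 := Finset.card_nsmul_le_sum _ _ _ this
      rw [Fin.card_Iic, nsmul_eq_mul, ← hS, mul_one_div, div_le_iff₀ hs] at h2
      exact_mod_cast h2
    have hSpos : 0 < S := pos_of_mul_pos_left (hm.trans_le hlow) hs.le
    have e : (1 / ((j : ℝ) + 1) * S)⁻¹ * (1 + 1 / (((j : ℝ) + 1) * q)) =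
        ((j : ℝ) + 1 + 1 / q) / S := by
      field_simp
    rw [e, le_div_iff₀ hSpos] at hj'
    have h3 : S * s ≤ 1 / q := by linarith
    rw [le_div_iff₀ hq] at h3
    linarith

lemma lowerRate_le {n : ℕ} (τ : Fin n → ℝ) (L Δ p σ ε : ℝ) (j : Fin n) :
    lowerRate τ L Δ p σ ε ≤ (1 / ((j : ℝ) + 1) * ∑ i ∈ Finset.Iic j, 1 / τ i)⁻¹ *
      (L * Δ / ε ^ 2 +
        L * σ ^ (p / (p - 1)) * Δ / (((j : ℝ) + 1) * ε ^ ((3 * p - 2) / (p - 1)))) :=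
  ciInf_le (Set.finite_range _).bddBelow j

lemma lowerRate_pos {n : ℕ} (hn : 1 ≤ n) {τ : Fin n → ℝ} (hτ : ∀ i, 0 < τ i) {L Δ p σ ε : ℝ}
    (hL : 0 < L) (hΔ : 0 < Δ) (hσ : 0 < σ) (hε : 0 < ε) : 0 < lowerRate τ L Δ p σ ε := by
  have : Nonempty (Fin n) := ⟨⟨0, hn⟩⟩
  obtain ⟨j, hj⟩ := exists_eq_ciInf_of_finite (f := fun j : Fin n =>
    (1 / ((j : ℝ) + 1) * ∑ i ∈ Finset.Iic j, 1 / τ i)⁻¹ * (L * Δ / ε ^ 2 +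
      L * σ ^ (p / (p - 1)) * Δ / (((j : ℝ) + 1) * ε ^ ((3 * p - 2) / (p - 1)))))
  rw [lowerRate, ← hj]
  have h1 : 0 < ∑ i ∈ Finset.Iic j, 1 / τ i :=
    Finset.sum_pos (fun i _ => one_div_pos.2 (hτ i)) ⟨j, Finset.mem_Iic.2 le_rfl⟩
  have h2 := Real.rpow_pos_of_pos hσ (p / (p - 1))
  have h3 := Real.rpow_pos_of_pos hε ((3 * p - 2) / (p - 1))
  positivity

/-- The success probability that makes the hidden coordinate as noisy as the moment bound
allows. -/
noncomputable def successProb (p σ ε : ℝ) : ℝ := min 1 ((128 * ε / σ) ^ (p / (p - 1)))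

lemma successProb_pos {p σ ε : ℝ} (hσ : 0 < σ) (hε : 0 < ε) : 0 < successProb p σ ε :=
  lt_min one_pos (Real.rpow_pos_of_pos (by positivity) _)

/-- With hidden coordinate at most `β = 64 * ε`, the choice of `q` makes the right side `(2 * β) ^
p`, and `2 ≤ 2 ^ p`. -/
lemma two_mul_rpow_le_of_successProb_lt_one {p σ ε : ℝ} (hp : 1 < p) (hσ : 0 < σ) (hε : 0 < ε)
    (h : successProb p σ ε < 1) :
    2 * (64 * ε) ^ p ≤ σ ^ p * successProb p σ ε ^ (p - 1) := by
  have e : successProb p σ ε = (128 * ε / σ) ^ (p / (p - 1)) := by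
    rcases min_choice 1 ((128 * ε / σ) ^ (p / (p - 1))) with h' | h'
    · exact absurd h' h.ne
    · exact h'
  have hp1 : p - 1 ≠ 0 := by linarith
  rw [e, ← Real.rpow_mul (by positivity), div_mul_cancel₀ _ hp1,
    ← Real.mul_rpow hσ.le (by positivity), mul_div_cancel₀ _ hσ.ne',
    show 128 * ε = 2 * (64 * ε) by ring,
    Real.mul_rpow (y := 64 * ε) (by norm_num) (by positivity)]
  have h2 : (2 : ℝ) ≤ 2 ^ p := by
    simpa using Real.rpow_le_rpow_of_exponent_le (x := 2) (by norm_num) hp.le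
  exact mul_le_mul_of_nonneg_right h2 (by positivity)

/-- Since `(3p-2)/(p-1) = 2 + p/(p-1)`, the factor `LΔ/ε²` splits off and leaves `(σ/ε)^(p/(p-1))`,
which is `1/q` up to a power of 128. -/
lemma rate_factor_le {p L Δ σ ε m : ℝ} (hp : 1 < p) (hL : 0 < L) (hΔ : 0 < Δ) (hσ : 0 < σ)
    (hε : 0 < ε) (hm : 0 < m) :
    L * Δ / ε ^ 2 + L * σ ^ (p / (p - 1)) * Δ / (m * ε ^ ((3 * p - 2) / (p - 1))) ≤
      128 ^ (p / (p - 1)) * (L * Δ / ε ^ 2) * (1 + 1 / (m * successProb p σ ε)) := by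
  set r := p / (p - 1) with hr
  have hp1 : 0 < p - 1 := by linarith
  have hr0 : 0 ≤ r := by positivity
  have hexp : (3 * p - 2) / (p - 1) = 2 + r := by rw [hr]; field_simp; ring
  have hK : (1 : ℝ) ≤ 128 ^ r := Real.one_le_rpow (by norm_num) hr0
  have hq := successProb_pos (p := p) hσ hε
  have hεr := Real.rpow_pos_of_pos hε r
  have hσr := Real.rpow_pos_of_pos hσ r
  have hqle : successProb p σ ε ≤ 128 ^ r * ε ^ r / σ ^ r := by
    rw [← Real.mul_rpow (by norm_num) hε.le, ← Real.div_rpow (by positivity) hσ.le]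
    exact min_le_right _ _
  have h1 : σ ^ r / ε ^ r ≤ 128 ^ r * (1 / successProb p σ ε) := by
    rw [div_le_iff₀ hεr, mul_one_div, div_mul_eq_mul_div, le_div_iff₀ hq]
    rwa [le_div_iff₀ hσr, mul_comm] at hqle
  have e : L * Δ / ε ^ 2 + L * σ ^ r * Δ / (m * ε ^ ((3 * p - 2) / (p - 1))) =
      (L * Δ / ε ^ 2) * (1 + (σ ^ r / ε ^ r) / m) := by
    rw [hexp, Real.rpow_add hε, Real.rpow_two]
    field_simp
  rw [e, mul_comm (128 ^ r : ℝ), mul_assoc]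
  refine mul_le_mul_of_nonneg_left ?_ (by positivity)
  calc 1 + σ ^ r / ε ^ r / m ≤ 128 ^ r + 128 ^ r * (1 / successProb p σ ε) / m := by gcongr
    _ = 128 ^ r * (1 + 1 / (m * successProb p σ ε)) := by field_simp

theorem mainTheorem4 :
    ∃ c : ℝ, 0 < c ∧ ∀ p : ℝ, 1 < p → p ≤ 2 → ∃ C : ℝ, 0 < C ∧
      ∀ (L Δ σ ε : ℝ), 0 < L → 0 < Δ → 0 < σ → 0 < ε → ε ≤ c * Real.sqrt (L * Δ) →
      ∀ (n : ℕ), 1 ≤ n → ∀ τ : Fin n → ℝ, (∀ i, 0 < τ i) → Monotone τ →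
      ∃ (d : ℕ) (f : Vec d → ℝ) (Ξ : Type) (_ : MeasurableSpace Ξ) (D : Measure Ξ)
        (G : Vec d → Ξ → Vec d),
        IsLSmooth L f ∧ BddBelow (Set.range f) ∧ f 0 - (⨅ x, f x) ≤ Δ ∧
        IsProbabilityMeasure D ∧ IsPBCMEstimator D p σ f G ∧
        ∀ (A : AsyncAlgorithm n d) (t : ℝ),
          A.expectedMinGrad τ D G f t ≤ ENNReal.ofReal ε →
          C * lowerRate τ L Δ p σ ε ≤ t := by
  refine ⟨1 / 256, by norm_num, fun p hp _ => ⟨(655360 * 128 ^ (p / (p - 1)))⁻¹, by positivity, ?_⟩⟩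
  intro L Δ σ ε hL hΔ hσ hε hεc n hn τ hτ hmono
  -- The dimension is `⌊X⌋`. The constant makes the range bound `L * lam ^ 2 / 5 * (2 * X)` equal to
  -- `Δ`; `c = 1/256` ensures `X ≥ 1` because `40960 ≤ 256 ^ 2`.
  set X := L * Δ / (40960 * ε ^ 2) with hX
  have hX1 : 1 ≤ X := by
    rw [hX, one_le_div (by positivity)]
    have h1 := pow_le_pow_left₀ hε.le hεc 2
    rw [mul_pow, Real.sq_sqrt (by positivity)] at h1
    have : 0 < L * Δ := by positivity
    linarith
  obtain ⟨d, hd⟩ : ∃ d, ⌊X⌋₊ = d + 1 :=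
    ⟨⌊X⌋₊ - 1, by have := (Nat.one_le_floor_iff X).2 hX1; omega⟩
  have hdX : (d : ℝ) + 1 ≤ X := by
    have := Nat.floor_le (show 0 ≤ X by linarith)
    rw [hd] at this
    exact_mod_cast this
  have hXd : X / 2 ≤ (d : ℝ) + 1 := by
    have := Nat.lt_floor_add_one X
    rw [hd] at this
    push_cast at this
    have : (0 : ℝ) ≤ d := Nat.cast_nonneg d
    linarith
  -- This makes the gradient at least `4 * ε` before the last coordinate is found, so the
  -- expectation is at least `2 * ε`, strictly above `ε`.
  set lam := 320 * ε / L with hlam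
  have hlam0 : 0 < lam := by positivity
  set q := successProb p σ ε with hq
  have hq0 : 0 < q := successProb_pos hσ hε
  have hq1 : q ≤ 1 := min_le_left _ _
  have hβ : L * lam / 5 = 64 * ε := by rw [hlam]; field_simp; norm_num
  have hγ : L * lam / 80 = 4 * ε := by rw [hlam]; field_simp; norm_num
  have hest : IsPBCMEstimator (coin q) p σ (scaledChain (d + 1) L lam)
      (maskedEstimator (scaledChainGrad L lam) q) :=
    isPBCMEstimator_maskedEstimator (β := 64 * ε) hp hq0 hq1 (by positivity) hσ
      (gradient_scaledChain L hlam0) (continuous_scaledChainGrad hL hlam0)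
      (fun x a h => h.scaledChainGrad L lam)
      (fun x j h => hβ ▸ h.abs_scaledChainGrad_le hL hlam0)
      (two_mul_rpow_le_of_successProb_lt_one hp hσ hε)
  refine ⟨d + 1, scaledChain (d + 1) L lam, Bool, inferInstance, coin q,
    maskedEstimator (scaledChainGrad L lam) q, isLSmooth_scaledChain hL hlam0,
    bddBelow_scaledChain hL lam, ?_, isProbabilityMeasure_coin hq0.le hq1, hest, ?_⟩
  · refine (scaledChain_zero_sub_iInf_le hL lam).trans ?_
    have h1 : ((d + 1 : ℕ) : ℝ) + 1 ≤ 2 * X := by push_cast; linarith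
    calc L * lam ^ 2 / 5 * (((d + 1 : ℕ) : ℝ) + 1) ≤ L * lam ^ 2 / 5 * (2 * X) := by gcongr
      _ = Δ := by rw [hX, hlam]; field_simp; norm_num
  · intro A t hA
    by_contra! hlt
    set R := lowerRate τ L Δ p σ ε with hR
    have hRpos : 0 < R := lowerRate_pos hn hτ hL hΔ hσ hε
    set K : ℝ := 128 ^ (p / (p - 1)) with hK
    have hKpos : 0 < K := Real.rpow_pos_of_pos (by norm_num) _
    -- Half the rate per unit of `K * (L * Δ / ε ^ 2)`: the largest `s` for which the bound on every
    -- `j` follows from `R` being a minimum.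
    set s := R / (2 * K * (L * Δ / ε ^ 2)) with hs
    have hspos : 0 < s := by positivity
    have hrate : q * s * ∑ i with τ i ≤ s, 1 / τ i ≤ 1 := by
      refine rate_mul_sum_le_one hτ hmono hq0 fun j => ?_
      have hH : 0 ≤ (1 / ((j : ℝ) + 1) * ∑ i ∈ Finset.Iic j, 1 / τ i)⁻¹ := by
        have : 0 ≤ ∑ i ∈ Finset.Iic j, 1 / τ i :=
          Finset.sum_nonneg fun i _ => one_div_nonneg.2 (hτ i).le
        positivity
      have h1 := (lowerRate_le τ L Δ p σ ε j).trans
        (mul_le_mul_of_nonneg_left (rate_factor_le hp hL hΔ hσ hε (by positivity)) hH)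
      have e : 2 * s = R / (K * (L * Δ / ε ^ 2)) := by rw [hs]; field_simp
      rw [e, div_le_iff₀ (by positivity)]
      exact h1.trans (le_of_eq (by ring))
    have ht : t ≤ s * (d + 1) / 4 := by
      refine hlt.le.trans ?_
      calc (655360 * K)⁻¹ * R = s * (X / 2) / 4 := by rw [hs, hX]; field_simp; norm_num
        _ ≤ s * (d + 1) / 4 := by gcongr
    have hE := A.ofReal_le_expectedMinGrad hτ
      (fun x a b h => (h.scaledChainGrad L lam).maskedEstimator (q := q) (b := b))
      (fun x a h => h.maskedEstimator_false) hq0.le hq1 hspos hrate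
      (f := scaledChain (d + 1) L lam) (γ := 4 * ε)
      (fun x hx => by
        rw [gradient_scaledChain L hlam0, ← hγ]
        exact le_norm_scaledChainGrad hL hlam0 x hx) ht
    have := (ENNReal.ofReal_le_ofReal_iff hε.le).1 (hE.trans hA)
    linarith
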